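/- Let $a(n),b(n)\in\mathbb R$ ($n\ge 1$) satisfy $(B+1)^{-1}\le a(n)\le B+1$ and $|b(n)|\le B$ for some $B>0$, put $a(0)=1$, and let $J$ be the half line Jacobi matrix $(Ju)(n)=a(n)u(n+1)+a(n-1)u(n-1)+b(n)u(n)$ (with $u(0)=0$) on $\ell_2(\{1,2,\dots\})$. A Herglotz function is a holomorphic map of $\mathbb C^+=\{z:\operatorname{Im}z>0\}$ to itself. For $z\in\mathbb C^+$ let $f_+(\cdot,z)$ be the solution of $a(n)f(n+1)+a(n-1)f(n-1)+b(n)f(n)=zf(n)$ ($n\ge 1$) with $f_+(0,z)=1$, $f_+(1,z)=-\langle\delta_1,(J-z)^{-1}\delta_1\rangle$, let $m_+(n,z)=-\dfrac{f_+(n+1,z)}{a(n)f_+(n,z)}$, and $$w_+^{(N)}(z)=\frac1N\sum_{n=1}^N\ln\left[a(n)m_+(n,z)\right],\qquad 0<\operatorname{Im}\ln<\pi .$$ Let $dk_N=\frac1N\sum_{n=1}^N\delta_{\lambda_n^{(N)}}$, where $\lambda_1^{(N)},\dots,\lambda_N^{(N)}$ are the eigenvalues of the truncation of $J$ to $\{1,\dots,N\}$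 (boundary conditions $u(0)=u(N+1)=0$). Let $N_j\to\infty$ be a sequence such that $w_+^{(N_j)}\to w_+$ uniformly on compact subsets of $\mathbb C^+$ for some Herglotz function $w_+$, and such that $dk_{N_j}\to dk$ in the weak-$*$ sense for some probability measure $dk$ on $\mathbb R$ (a density of states measure). Let $\gamma(z)=-\operatorname{Re}w_+(z)$ for $z\in\mathbb C^+$ and $g(z)=\int_{\mathbb R}\frac{dk(t)}{t-z}$. Then the limit $\gamma(t)=\lim_{y\to0+}\gamma(t+iy)\in\mathbb R$ exists for every $t\in\mathbb R$, and, with $$K=\{c\in\mathbb R:|\gamma^{-1}(\{c\})|>0\},\qquad C=\gamma^{-1}(K)$$ (where $\gamma$ is regarded as a function on $\mathbb R$ and $|\cdot|$ is Lebesgue measure), $g$ is reflectionless on $C$: $g$ is a Herglotz function, and for Lebesgue almost every $t\in C$ the limit $\lim_{y\to0+}g(t+iy)$ exists and has real part $0$. In particular, $dk$ is reflectionless on the set $U$ of all points that have a neighborhood in $\mathbb R$ on which $\gamma$ is constant; that is, $\int_{\mathbb R}\frac{dk(t)}{t^2+1}<\infty$, and for some $\alpha\in\mathbb R$, $\beta\ge0$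 the function $F(z)=\alpha+\beta z+\int_{\mathbb R}\left(\frac1{t-z}-\frac t{t^2+1}\right)dk(t)$ is a Herglotz function that has, at almost every $t\in U$, a boundary value $\lim_{y\to0+}F(t+iy)$ with real part $0$. -/

import Mathlib

open MeasureTheory Filter Topology
open scoped ENNReal

noncomputable section

namespace Jacobi

/-! ### Herglotz functions and reflectionless measures -/

/-- The open upper half plane as a subset of `ℂ`. -/
def upperHalf : Set ℂ := {z | 0 < z.im}

/-- Herglotz functions: holomorphic maps of the open upper half plane to itself (the values off the
upper half plane are irrelevant). -/
def IsHerglotz (F : ℂ → ℂ) : Prop :=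
  DifferentiableOn ℂ F upperHalf ∧ Set.MapsTo F upperHalf upperHalf

/-- The class of Herglotz functions that are reflectionless on `E`: at Lebesgue almost every
`t ∈ E` the boundary value `lim_{y → 0+} F (t + i y)` has zero real part. -/
def reflectionlessFunctions (E : Set ℝ) : Set (ℂ → ℂ) :=
  {F | IsHerglotz F ∧
    ∀ᵐ t : ℝ, t ∈ E → ∃ c : ℂ,
      Tendsto (fun y : ℝ => F (t + y * Complex.I)) (𝓝[>] 0) (𝓝 c) ∧ c.re = 0}

/-- The function `α + β z + ∫ (1 / (t - z) - t / (t² + 1)) dμ(t)`. -/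
def herglotzIntegral (α β : ℝ) (μ : Measure ℝ) (z : ℂ) : ℂ :=
  α + β * z + ∫ t : ℝ, (1 / ((t : ℂ) - z) - (t : ℂ) / ((t : ℂ) ^ 2 + 1)) ∂μ

/-- The class of positive Borel measures that are reflectionless on `E`. -/
def reflectionlessMeasures (E : Set ℝ) : Set (Measure ℝ) :=
  {μ | ∫⁻ t : ℝ, ENNReal.ofReal (1 / (t ^ 2 + 1)) ∂μ < ∞ ∧
    ∃ α β : ℝ, 0 ≤ β ∧ herglotzIntegral α β μ ∈ reflectionlessFunctions E}

/-! ### Half line Jacobi matrices -/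

/-- Coefficients `a n`, `b n` (`n ≥ 1`) of a half line Jacobi matrix, subject to the uniform bounds
`(C + 1)⁻¹ ≤ a n ≤ C + 1`, `|b n| ≤ C`. By convention `a 0 = 1`; the value `b 0` is never used. -/
structure Coefficients where
  a : ℕ → ℝ
  b : ℕ → ℝ
  a_zero : a 0 = 1
  bounds : ∃ C : ℝ, 0 < C ∧ ∀ n : ℕ, 1 ≤ n → (C + 1)⁻¹ ≤ a n ∧ a n ≤ C + 1 ∧ |b n| ≤ C

/-- The Hilbert space of square summable sequences on the sites `1, 2, 3, …`; the coordinate with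
index `k : ℕ` belongs to the site `k + 1`. -/
abbrev EllTwo : Type := lp (fun _ : ℕ => ℂ) 2

theorem memℓp_mul_bounded {c : ℕ → ℝ} {M : ℝ} (hc : ∀ k, |c k| ≤ M) {u : ℕ → ℂ}
    (hu : Memℓp u 2) : Memℓp (fun k => (c k : ℂ) * u k) 2 := by
  refine (hu.const_smul (M : ℂ)).mono' ?_
  intro k
  have hM : 0 ≤ M := (abs_nonneg _).trans (hc k)
  simp only [Pi.smul_apply, smul_eq_mul, norm_mul, Complex.norm_real, Real.norm_eq_abs,
    abs_of_nonneg hM]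
  exact mul_le_mul_of_nonneg_right (hc k) (norm_nonneg _)

theorem memℓp_succ {u : ℕ → ℂ} (hu : Memℓp u 2) : Memℓp (fun k => u (k + 1)) 2 := by
  have h2 : 0 < (2 : ℝ≥0∞).toReal := by norm_num
  exact (memℓp_gen_iff h2).2 ((summable_nat_add_iff 1).2 ((memℓp_gen_iff h2).1 hu))

theorem memℓp_of_succ {u : ℕ → ℂ} (hu : Memℓp (fun k => u (k + 1)) 2) : Memℓp u 2 := by
  have h2 : 0 < (2 : ℝ≥0∞).toReal := by norm_num
  exact (memℓp_gen_iff h2).2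
    ((summable_nat_add_iff (f := fun k => ‖u k‖ ^ (2 : ℝ≥0∞).toReal) 1).1
      ((memℓp_gen_iff h2).1 hu))

namespace Coefficients

variable (p : Coefficients)

/-- The Jacobi difference expression `a n u (n+1) + a (n-1) u (n-1) + b n u n` at the site
`n = k + 1`, where `u` vanishes at the site `0`. -/
def action (u : ℕ → ℂ) : ℕ → ℂ
  | 0 => (p.a 1 : ℂ) * u 1 + (p.b 1 : ℂ) * u 0
  | k + 1 => (p.a (k + 2) : ℂ) * u (k + 2) + (p.a (k + 1) : ℂ) * u k
      + (p.b (k + 2) : ℂ) * u (k + 1)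

theorem exists_bound : ∃ M : ℝ, (∀ k, |p.a (k + 1)| ≤ M) ∧ ∀ k, |p.b (k + 1)| ≤ M := by
  obtain ⟨C, hC, h⟩ := p.bounds
  refine ⟨C + 1, fun k => ?_, fun k => ?_⟩
  · obtain ⟨h1, h2, -⟩ := h (k + 1) (by omega)
    have : 0 < (C + 1)⁻¹ := by positivity
    rw [abs_of_nonneg (by linarith)]
    exact h2
  · obtain ⟨-, -, h3⟩ := h (k + 1) (by omega)
    linarith

theorem memℓp_action {u : ℕ → ℂ} (hu : Memℓp u 2) : Memℓp (p.action u) 2 := by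
  obtain ⟨M, ha, hb⟩ := p.exists_bound
  refine memℓp_of_succ ?_
  exact ((memℓp_mul_bounded (fun k => ha (k + 1)) (memℓp_succ (memℓp_succ hu))).add
    (memℓp_mul_bounded ha hu)).add (memℓp_mul_bounded (fun k => hb (k + 1)) (memℓp_succ hu))

/-- The Jacobi matrix as a linear map on square summable sequences. -/
def operatorLin : EllTwo →ₗ[ℂ] EllTwo where
  toFun u := ⟨p.action u, p.memℓp_action (lp.memℓp u)⟩
  map_add' u v := by
    ext k
    change p.action (fun k => (u : ℕ → ℂ) k + (v : ℕ → ℂ) k) k = p.action u k + p.action v k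
    cases k <;> simp only [action] <;> ring
  map_smul' c u := by
    ext k
    change p.action (fun k => c * (u : ℕ → ℂ) k) k = c * p.action u k
    cases k <;> simp only [action] <;> ring

theorem continuous_coord (k : ℕ) : Continuous fun u : EllTwo => (u : ℕ → ℂ) k :=
  (_root_.continuous_apply k).comp
    (lp.uniformContinuous_coe (E := fun _ : ℕ => ℂ) (p := 2)).continuous

theorem continuous_action (k : ℕ) : Continuous fun u : EllTwo => p.action u k := by
  cases k with
  | zero =>
    exact ((continuous_coord 1).const_mul _).add ((continuous_coord 0).const_mul _)
  | succ k =>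
    exact (((continuous_coord (k + 2)).const_mul _).add ((continuous_coord k).const_mul _)).add
      ((continuous_coord (k + 1)).const_mul _)

/-- The Jacobi matrix `J` as a bounded operator on square summable sequences. -/
def operator : EllTwo →L[ℂ] EllTwo :=
  ContinuousLinearMap.ofSeqClosedGraph (g := p.operatorLin) (by
    intro u x y hu hJu
    ext k
    have h1 := ((p.continuous_action k).tendsto x).comp hu
    have h2 := ((continuous_coord k).tendsto y).comp hJu
    exact tendsto_nhds_unique h2 h1)

theorem operator_apply (u : EllTwo) (k : ℕ) : (p.operator u : ℕ → ℂ) k = p.action u k := rfl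

/-- The unit vector at the site `1`. -/
def deltaOne : EllTwo := lp.single 2 0 1

/-- The Titchmarsh-Weyl function `m₊ z = ⟨δ₁, (J - z)⁻¹ δ₁⟩`. -/
def mPlus (z : ℂ) : ℂ :=
  inner ℂ deltaOne (Ring.inverse (p.operator - z • (1 : EllTwo →L[ℂ] EllTwo)) deltaOne)

/-- The solution `f₊` of `a n f (n+1) + a (n-1) f (n-1) + b n f n = z f n` (`n ≥ 1`) with
`f₊ 0 = 1`, `f₊ 1 = -m₊ z`. -/
def fPlus (z : ℂ) : ℕ → ℂ
  | 0 => 1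
  | 1 => -p.mPlus z
  | n + 2 => ((z - (p.b (n + 1) : ℂ)) * fPlus z (n + 1) - (p.a n : ℂ) * fPlus z n)
      / (p.a (n + 1) : ℂ)

/-- The Herglotz functions `m₊(n, z) = - f₊(n+1, z) / (a(n) f₊(n, z))`. -/
def mPlusAt (n : ℕ) (z : ℂ) : ℂ := -(p.fPlus z (n + 1) / ((p.a n : ℂ) * p.fPlus z n))

/-- The averages `w₊^(N)(z) = (1/N) ∑_{n=1}^N ln (a(n) m₊(n, z))`. The principal logarithm has
imaginary part in `(0, π)` on the upper half plane. -/
def wPlus (N : ℕ) (z : ℂ) : ℂ :=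
  (1 / (N : ℂ)) * ∑ n ∈ Finset.Icc 1 N, Complex.log ((p.a n : ℂ) * p.mPlusAt n z)

/-- The truncation of `J` to the sites `1, …, N`, with zero boundary conditions at `0` and `N+1`;
the index `i : Fin N` belongs to the site `i + 1`. -/
def truncation (N : ℕ) : Matrix (Fin N) (Fin N) ℝ :=
  Matrix.of fun i j =>
    if (i : ℕ) = j then p.b (i + 1)
    else if (j : ℕ) = i + 1 then p.a (i + 1)
    else if (i : ℕ) = j + 1 then p.a (j + 1)
    else 0

theorem truncation_isHermitian (N : ℕ) : (p.truncation N).IsHermitian := by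
  refine Matrix.IsHermitian.ext fun i j => ?_
  simp only [truncation, Matrix.of_apply, star_trivial]
  by_cases h : (i : ℕ) = j
  · simp [h]
  · have h' : ¬ (j : ℕ) = i := fun e => h e.symm
    by_cases h1 : (j : ℕ) = i + 1
    · have h2 : ¬ (i : ℕ) = j + 1 := by omega
      rw [if_neg h, if_pos h1, if_neg h', if_neg h2, if_pos h1]
    · rw [if_neg h, if_neg h1, if_neg h']
      simp only [if_neg h1]

/-- The normalized eigenvalue counting measure `dk_N = (1/N) ∑ δ_{λ_n^(N)}` of the truncation. -/
def eigenvalueMeasure (N : ℕ) : Measure ℝ :=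
  (N : ℝ≥0∞)⁻¹ • ∑ i : Fin N, Measure.dirac ((p.truncation_isHermitian N).eigenvalues i)

/-- Along the subsequence `N`, the functions `w₊^(N j)` converge to the Herglotz function `w`,
uniformly on compact subsets of the upper half plane. -/
def ConvergesAlong (N : ℕ → ℕ) (w : ℂ → ℂ) : Prop :=
  IsHerglotz w ∧ ∀ S : Set ℂ, IsCompact S → S ⊆ upperHalf →
    TendstoUniformlyOn (fun j => p.wPlus (N j)) w atTop S

/-- `k` is the density of states measure along the subsequence `N`: the probability measure that is
the weak-star limit of the eigenvalue counting measures. -/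
def IsDensityOfStates (N : ℕ → ℕ) (k : Measure ℝ) : Prop :=
  IsProbabilityMeasure k ∧ ∀ f : ℝ → ℝ, Continuous f → HasCompactSupport f →
    Tendsto (fun j => ∫ t, f t ∂p.eigenvalueMeasure (N j)) atTop (𝓝 (∫ t, f t ∂k))

end Coefficients

/-- The Lyapunov exponent `γ = -Re w₊` on the upper half plane. -/
def lyapunov (w : ℂ → ℂ) (z : ℂ) : ℝ := -(w z).re

/-- The Lyapunov exponent on the real line, `γ t = lim_{y → 0+} γ (t + i y)`. -/
def lyapunovReal (w : ℂ → ℂ) (t : ℝ) : ℝ :=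
  limUnder (𝓝[>] (0 : ℝ)) fun y : ℝ => lyapunov w (t + y * Complex.I)

/-- The Borel transform `g z = ∫ dk(t) / (t - z)`. -/
def borelTransform (k : Measure ℝ) (z : ℂ) : ℂ := ∫ t : ℝ, 1 / ((t : ℂ) - z) ∂k

/-- The values `c` whose level set has positive Lebesgue measure. -/
def fatValues (γ : ℝ → ℝ) : Set ℝ := {c | 0 < volume (γ ⁻¹' {c})}

/-- The open set of all points near which `γ` is constant. -/
def locallyConstantSet (γ : ℝ → ℝ) : Set ℝ := {t | ∀ᶠ s in 𝓝 t, γ s = γ t}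

end Jacobi

end

noncomputable section

namespace Jacobi

/-! ### Self-adjointness of $J$ and the resolvent vector. -/

namespace Coefficients

variable (p : Coefficients)

/-! The key is the Thouless formula `lyapunov_eq`: up to a constant, $\gamma$ is
$-\operatorname{Re}\Phi$ for a holomorphic $\Phi$ (`complexPotential`) with $\Phi'=g$.

To obtain it, $\operatorname{Re}w_+^{(N)}$ telescopes to $\frac1N\ln|f_+(N+1)|$ up to $O(1/N)$
(`re_wPlus`). The characteristic polynomial of the truncation is $\prod a(n)$ times the Dirichlet
solution $d(N+1)$ (`det_charMatrix_eq`). Constancy of the Wronskian, with Riccati bounds, keeps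
$f_+d$ bounded and bounded away from zero (`norm_fPlus_mul_bounds`). Hence $\ln|f_+|$ is minus the
logarithmic potential of the eigenvalues plus $\sum\ln a(n)$, up to $O(1)$, and the last sum cancels
in differences between two points $z$.

Since $\partial_y\gamma=\operatorname{Im}g>0$ and $\gamma\ge0$ (because $f_+$ decays), $\gamma$ has
a vertical limit at every real point.

By Fatou's theorem `ae_exists_hasConeLimit_borelTransform`, $g$ has a limit in a cone at almost
every real $t$. Suppose $g$ is close to one value $q$, $\operatorname{Re}q\ne0$, on the cones over
two close points $s<t$ of the same level set. Integrating $g$ from $s$ to $t$ through a point common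
to both cones gives $\operatorname{Re}q\,(t-s)\approx\gamma(s)-\gamma(t)=0$, a contradiction. So
each level set has only countably many points where the cone limit exists with nonzero real part
(`countable_levelSet_inter`). Only countably many levels have positive measure, so the total
exceptional set is null. -/

theorem a_pos (n : ℕ) : 0 < p.a n := by
  rcases Nat.eq_zero_or_pos n with rfl | hn
  · rw [p.a_zero]; exact one_pos
  · obtain ⟨C, hC, h⟩ := p.bounds
    exact lt_of_lt_of_le (by positivity) (h n hn).1

theorem a_ne_zero (n : ℕ) : (p.a n : ℂ) ≠ 0 := by
  exact_mod_cast (p.a_pos n).ne'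

theorem memℓp_tendsto_zero {u : ℕ → ℂ} (hu : Memℓp u 2) : Tendsto u atTop (𝓝 0) := by
  have h2 : 0 < (2 : ℝ≥0∞).toReal := by norm_num
  have h := ((memℓp_gen_iff h2).1 hu).tendsto_atTop_zero
  rw [tendsto_zero_iff_norm_tendsto_zero]
  have h' : Tendsto (fun k => Real.sqrt (‖u k‖ ^ (2 : ℝ≥0∞).toReal)) atTop (𝓝 0) := by
    simpa [Function.comp_def] using (Real.continuous_sqrt.tendsto 0).comp h
  refine h'.congr fun k => ?_
  simp

/-- Green's identity for partial sums of the Jacobi difference expression. -/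
theorem sum_green (u v : ℕ → ℂ) (n : ℕ) :
    ∑ k ∈ Finset.range (n + 1), (v k * star (p.action u k) - p.action v k * star (u k)) =
      (p.a (n + 1) : ℂ) * (v n * star (u (n + 1)) - v (n + 1) * star (u n)) := by
  induction n with
  | zero => simp [action]; ring
  | succ n ih =>
    rw [Finset.sum_range_succ, ih]
    simp [action]
    ring

/-- In Green's identity the boundary term tends to zero: the $a(n)$ are bounded and square summable
sequences tend to zero. -/
theorem isSelfAdjoint_operator : IsSelfAdjoint p.operator := by
  rw [ContinuousLinearMap.isSelfAdjoint_iff_isSymmetric]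
  intro u v
  change inner ℂ (p.operator u) v = inner ℂ u (p.operator v)
  have hs1 := lp.hasSum_inner (𝕜 := ℂ) (G := fun _ : ℕ => ℂ) (p.operator u) v
  have hs2 := lp.hasSum_inner (𝕜 := ℂ) (G := fun _ : ℕ => ℂ) u (p.operator v)
  have h1 := HasSum.sub hs1 hs2
  have h2 := (h1.tendsto_sum_nat.comp (tendsto_add_atTop_nat 1))
  obtain ⟨M, ha, -⟩ := p.exists_bound
  have hu := memℓp_tendsto_zero (lp.memℓp u)
  have hv := memℓp_tendsto_zero (lp.memℓp v)
  have h3 : Tendsto (fun n => (p.a (n + 1) : ℂ) *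
      ((v : ℕ → ℂ) n * star ((u : ℕ → ℂ) (n + 1)) - (v : ℕ → ℂ) (n + 1) * star ((u : ℕ → ℂ) n)))
      atTop (𝓝 0) := by
    have h4 : Tendsto (fun n => (v : ℕ → ℂ) n * star ((u : ℕ → ℂ) (n + 1)) -
        (v : ℕ → ℂ) (n + 1) * star ((u : ℕ → ℂ) n)) atTop (𝓝 0) := by
      have hu1 := hu.comp (tendsto_add_atTop_nat 1)
      have hv1 := hv.comp (tendsto_add_atTop_nat 1)
      simpa using (hv.mul hu1.star).sub (hv1.mul hu.star)
    refine squeeze_zero_norm (fun n => ?_) (by simpa using h4.norm.const_mul M)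
    rw [norm_mul, Complex.norm_real, Real.norm_eq_abs]
    exact mul_le_mul_of_nonneg_right (ha n) (norm_nonneg _)
  have h5 := tendsto_nhds_unique h2 (h3.congr fun n => (by
    rw [← p.sum_green]
    simp only [Function.comp]
    refine Finset.sum_congr rfl fun k _ => ?_
    rw [operator_apply, operator_apply]
    simp [RCLike.inner_apply]))
  exact sub_eq_zero.1 h5

/-- The resolvent applied to the unit vector at the site `1`. -/
def resolventVector (z : ℂ) : EllTwo :=
  Ring.inverse (p.operator - z • (1 : EllTwo →L[ℂ] EllTwo)) deltaOne

theorem isUnit_operator_sub {z : ℂ} (hz : 0 < z.im) :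
    IsUnit (p.operator - z • (1 : EllTwo →L[ℂ] EllTwo)) := by
  have h : z ∉ spectrum ℂ p.operator := fun h =>
    hz.ne' (p.isSelfAdjoint_operator.im_eq_zero_of_mem_spectrum h)
  rw [spectrum.notMem_iff, Algebra.algebraMap_eq_smul_one] at h
  simpa using h.neg

theorem operator_resolventVector {z : ℂ} (hz : 0 < z.im) :
    p.operator (p.resolventVector z) - z • p.resolventVector z = deltaOne := by
  have h := Ring.mul_inverse_cancel _ (p.isUnit_operator_sub hz)
  have h' := congrArg (fun T : EllTwo →L[ℂ] EllTwo => T deltaOne) h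
  simpa [resolventVector] using h'

theorem action_resolventVector {z : ℂ} (hz : 0 < z.im) (k : ℕ) :
    p.action (p.resolventVector z) k - z * (p.resolventVector z : ℕ → ℂ) k =
      if k = 0 then 1 else 0 := by
  have h := congrArg (fun u : EllTwo => (u : ℕ → ℂ) k) (p.operator_resolventVector hz)
  have h2 : (deltaOne : ℕ → ℂ) k = if k = 0 then 1 else 0 := by
    simp [deltaOne, Pi.single_apply]
  rw [← h2, ← h, ← operator_apply]
  rfl

theorem mPlus_eq (z : ℂ) : p.mPlus z = (p.resolventVector z : ℕ → ℂ) 0 := by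
  rw [mPlus, ← resolventVector, deltaOne, lp.inner_single_left]
  simp

/-! ### Decaying and Dirichlet solutions, flux and Wronskian. -/

/-- The solutions of the Jacobi difference equation with spectral parameter `z`. -/
def IsSolution (z : ℂ) (f : ℕ → ℂ) : Prop :=
  ∀ n, (p.a (n + 1) : ℂ) * f (n + 2) + (p.a n : ℂ) * f n + (p.b (n + 1) : ℂ) * f (n + 1) =
    z * f (n + 1)

theorem isSolution_fPlus (z : ℂ) : p.IsSolution z (p.fPlus z) := by
  intro n
  rw [fPlus]
  field_simp [p.a_ne_zero (n + 1)]
  ring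

/-- The solution of the difference equation that vanishes at `0` and has the value `1` at `1`. -/
def dirichletSolution (z : ℂ) : ℕ → ℂ
  | 0 => 0
  | 1 => 1
  | n + 2 => ((z - (p.b (n + 1) : ℂ)) * dirichletSolution z (n + 1)
      - (p.a n : ℂ) * dirichletSolution z n) / (p.a (n + 1) : ℂ)

theorem isSolution_dirichletSolution (z : ℂ) : p.IsSolution z (p.dirichletSolution z) := by
  intro n
  rw [dirichletSolution]
  field_simp [p.a_ne_zero (n + 1)]
  ring

/-- Both sides obey the same recursion; at the first site the source $\delta_1$ of the resolvent
equation is matched by $a(0)f_+(0)=1$. This is what makes $f_+$ decay. -/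
theorem fPlus_succ {z : ℂ} (hz : 0 < z.im) (k : ℕ) :
    p.fPlus z (k + 1) = -(p.resolventVector z : ℕ → ℂ) k := by
  induction k using Nat.strong_induction_on with
  | _ k ih =>
    match k with
    | 0 => rw [fPlus, mPlus_eq]
    | 1 =>
      have h := p.action_resolventVector hz 0
      rw [fPlus, ih 0 (by omega), fPlus, p.a_zero, div_eq_iff (p.a_ne_zero 1)]
      simp only [action, if_true] at h
      push_cast
      linear_combination h
    | k + 2 =>
      have h := p.action_resolventVector hz (k + 1)
      rw [fPlus, ih (k + 1) (by omega), ih k (by omega), div_eq_iff (p.a_ne_zero _)]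
      simp only [action, Nat.succ_ne_zero, if_false] at h
      linear_combination h

theorem tendsto_fPlus {z : ℂ} (hz : 0 < z.im) : Tendsto (p.fPlus z) atTop (𝓝 0) := by
  rw [← tendsto_add_atTop_iff_nat 1]
  have h := (memℓp_tendsto_zero (lp.memℓp (p.resolventVector z))).neg
  rw [neg_zero] at h
  exact h.congr fun k => (p.fPlus_succ hz k).symm

/-- The imaginary Wronskian of a solution. -/
def flux (f : ℕ → ℂ) (n : ℕ) : ℝ := p.a n * (star (f n) * f (n + 1)).im

variable {p}

theorem IsSolution.flux_succ {z : ℂ} {f : ℕ → ℂ} (hf : p.IsSolution z f) (n : ℕ) :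
    p.flux f (n + 1) = p.flux f n + z.im * ‖f (n + 1)‖ ^ 2 := by
  have h := congrArg (fun x : ℂ => (star (f (n + 1)) * x).im) (hf n)
  simp only [flux]
  rw [← Complex.normSq_eq_norm_sq, Complex.normSq_apply]
  simp at h ⊢
  linear_combination h

theorem IsSolution.eq_zero {z : ℂ} {f : ℕ → ℂ} (hf : p.IsSolution z f) {n : ℕ}
    (h0 : f n = 0) (h1 : f (n + 1) = 0) : f 0 = 0 := by
  induction n with
  | zero => exact h0
  | succ n ih =>
    have h := hf n
    rw [h0, h1] at h
    have h2 : f n = 0 := by simpa [p.a_ne_zero n] using h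
    exact ih h2 h0

theorem IsSolution.wronskian {z : ℂ} {f g : ℕ → ℂ} (hf : p.IsSolution z f)
    (hg : p.IsSolution z g) (n : ℕ) :
    (p.a n : ℂ) * (f n * g (n + 1) - f (n + 1) * g n) = f 0 * g 1 - f 1 * g 0 := by
  induction n with
  | zero => simp [p.a_zero]
  | succ n ih =>
    rw [← ih]
    linear_combination f (n + 1) * hg n - g (n + 1) * hf n

variable (p)

/-- The flux is nondecreasing and tends to zero, hence is nonpositive. If it vanished once it would
vanish from there on, forcing two consecutive zeros of $f_+$ and so $f_+(0)=0$. -/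
theorem flux_fPlus_neg {z : ℂ} (hz : 0 < z.im) (n : ℕ) : p.flux (p.fPlus z) n < 0 := by
  have hsol := p.isSolution_fPlus z
  have hmono : Monotone (p.flux (p.fPlus z)) := monotone_nat_of_le_succ fun n => by
    rw [hsol.flux_succ]
    exact le_add_of_nonneg_right (by positivity)
  have hlim : Tendsto (p.flux (p.fPlus z)) atTop (𝓝 0) := by
    obtain ⟨M, ha, -⟩ := p.exists_bound
    have h0 := p.tendsto_fPlus hz
    have h1 := h0.comp (tendsto_add_atTop_nat 1)
    rw [← tendsto_add_atTop_iff_nat 1]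
    have h2 := ((h0.star.mul h1).norm.const_mul M).comp (tendsto_add_atTop_nat 1)
    refine squeeze_zero_norm (fun k => ?_) (by simpa using h2)
    rw [flux, Real.norm_eq_abs, abs_mul]
    refine mul_le_mul (ha k) ((Complex.abs_im_le_norm _).trans_eq (by simp)) (abs_nonneg _)
      ((abs_nonneg _).trans (ha k))
  have hle : ∀ m, p.flux (p.fPlus z) m ≤ 0 := fun m => hmono.ge_of_tendsto hlim m
  refine lt_of_le_of_ne (hle n) fun h => ?_
  have hz0 : ∀ m, n ≤ m → p.flux (p.fPlus z) m = 0 := fun m hm =>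
    le_antisymm (hle m) (h ▸ hmono hm)
  have hf : ∀ m, n ≤ m → p.fPlus z (m + 1) = 0 := fun m hm => by
    have h1 := hsol.flux_succ m
    rw [hz0 m hm, hz0 (m + 1) (by omega)] at h1
    have h2 : ‖p.fPlus z (m + 1)‖ ^ 2 = 0 := by
      have := hz.ne'
      simpa [this] using h1.symm
    simpa using h2
  have := hsol.eq_zero (hf n le_rfl) (hf (n + 1) (by omega))
  rw [fPlus] at this
  exact one_ne_zero this

theorem fPlus_ne_zero {z : ℂ} (hz : 0 < z.im) (n : ℕ) : p.fPlus z n ≠ 0 := fun h => by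
  have := p.flux_fPlus_neg hz n
  simp [flux, h] at this

theorem flux_dirichletSolution_pos {z : ℂ} (hz : 0 < z.im) (n : ℕ) :
    0 < p.flux (p.dirichletSolution z) (n + 1) := by
  have hsol := p.isSolution_dirichletSolution z
  induction n with
  | zero => rw [hsol.flux_succ]; simp [flux, dirichletSolution, hz]
  | succ n ih => rw [hsol.flux_succ]; positivity

theorem dirichletSolution_ne_zero {z : ℂ} (hz : 0 < z.im) (n : ℕ) :
    p.dirichletSolution z (n + 1) ≠ 0 := fun h => by
  have := p.flux_dirichletSolution_pos hz n
  simp [flux, h] at this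

theorem im_div_eq {x y : ℂ} : (x / y).im = (star y * x).im / ‖y‖ ^ 2 := by
  rw [← Complex.normSq_eq_norm_sq, Complex.div_im]
  simp
  ring

theorem im_div_eq' {x y : ℂ} : (x / y).im = -(star x * y).im / ‖y‖ ^ 2 := by
  rw [im_div_eq]
  simp
  ring

/-- Lower bound for the imaginary part of the Riccati variable of the decaying solution. -/
theorem im_le_fPlus_div {z : ℂ} (hz : 0 < z.im) (n : ℕ) :
    z.im ≤ (p.a n * (p.fPlus z n / p.fPlus z (n + 1))).im := by
  have hne := p.fPlus_ne_zero hz (n + 1)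
  have h : (p.a n : ℂ) * (p.fPlus z n / p.fPlus z (n + 1)) =
      z - p.b (n + 1) - p.a (n + 1) * (p.fPlus z (n + 2) / p.fPlus z (n + 1)) := by
    field_simp
    linear_combination p.isSolution_fPlus z n
  have h2 := p.flux_fPlus_neg hz (n + 1)
  rw [h]
  simp only [Complex.sub_im, Complex.ofReal_im, Complex.im_ofReal_mul, sub_zero]
  rw [im_div_eq, ← mul_div_assoc]
  rw [flux] at h2
  have := div_neg_of_neg_of_pos h2 (show 0 < ‖p.fPlus z (n + 1)‖ ^ 2 by positivity)
  linarith

theorem im_le_dirichletSolution_div {z : ℂ} (hz : 0 < z.im) (n : ℕ) :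
    z.im ≤ (p.a (n + 1) * (p.dirichletSolution z (n + 2) / p.dirichletSolution z (n + 1))).im := by
  have h2 : p.flux (p.dirichletSolution z) (n + 1) ≥
      z.im * ‖p.dirichletSolution z (n + 1)‖ ^ 2 := by
    rw [(p.isSolution_dirichletSolution z).flux_succ]
    have : 0 ≤ p.flux (p.dirichletSolution z) n := by
      cases n with
      | zero => simp [flux, dirichletSolution]
      | succ n => exact (p.flux_dirichletSolution_pos hz n).le
    linarith
  have hne := p.dirichletSolution_ne_zero hz n
  rw [Complex.im_ofReal_mul, im_div_eq, ← mul_div_assoc, le_div_iff₀ (by positivity)]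
  exact h2

/-- The product of the decaying and the Dirichlet solution stays bounded, and bounded away from
zero, along the half line. -/
theorem norm_fPlus_mul_bounds {z : ℂ} (hz : 0 < z.im) :
    ∃ c C : ℝ, 0 < c ∧ ∀ n, c ≤ ‖p.fPlus z (n + 2) * p.dirichletSolution z (n + 2)‖ ∧
      ‖p.fPlus z (n + 2) * p.dirichletSolution z (n + 2)‖ ≤ C := by
  obtain ⟨M, ha, hb⟩ := p.exists_bound
  have hM : 0 < M := (abs_pos.2 (p.a_pos 1).ne').trans_le (ha 0)
  -- One summand for each of the four terms in the formula `he` for $q$ below.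
  set K := ‖z‖ + M + M * (M / z.im) + M * (M / z.im) with hK
  have hK0 : 0 < K := by positivity
  refine ⟨K⁻¹, z.im⁻¹, by positivity, fun n => ?_⟩
  set f := p.fPlus z
  set d := p.dirichletSolution z
  have hfn : ∀ m, f m ≠ 0 := p.fPlus_ne_zero hz
  have hd1 : d (n + 1) ≠ 0 := p.dirichletSolution_ne_zero hz n
  have hd2 : d (n + 2) ≠ 0 := p.dirichletSolution_ne_zero hz (n + 1)
  have ha' : ∀ m, p.a (m + 1) ≤ M := fun m => (le_abs_self _).trans (ha m)
  -- The Wronskian of $f_+$ and $d$ equals $1$, its value at site $0$; so bounds for $f_+d$ are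
  -- bounds for $q^{-1}$.
  have hW : (p.a (n + 1) : ℂ) * (f (n + 1) / f (n + 2) - d (n + 1) / d (n + 2)) *
      (f (n + 2) * d (n + 2)) = 1 := by
    have h := (p.isSolution_fPlus z).wronskian (p.isSolution_dirichletSolution z) (n + 1)
    simp only [fPlus, dirichletSolution] at h
    change (p.a (n + 1) : ℂ) * (f (n + 1) * d (n + 2) - f (n + 2) * d (n + 1)) = _ at h
    have h1 := hfn (n + 2)
    field_simp
    linear_combination h
  set q := (p.a (n + 1) : ℂ) * (f (n + 1) / f (n + 2) - d (n + 1) / d (n + 2))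
  have hq : ‖q‖ * ‖f (n + 2) * d (n + 2)‖ = 1 := by rw [← norm_mul, hW, norm_one]
  have hq0 : 0 < ‖q‖ := by
    rcases (norm_nonneg q).eq_or_lt with h | h
    · rw [← h, zero_mul] at hq; exact absurd hq zero_ne_one
    · exact h
  have hqe : ‖f (n + 2) * d (n + 2)‖ = ‖q‖⁻¹ := eq_inv_of_mul_eq_one_right hq
  -- Both quotients contribute to $\operatorname{Im}q$ with the same sign, so they cannot cancel.
  have hlow : z.im ≤ ‖q‖ := by
    refine le_trans ?_ ((le_abs_self _).trans (Complex.abs_im_le_norm q))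
    have h1 := p.im_le_fPlus_div hz (n + 1)
    have h2 : (d (n + 1) / d (n + 2)).im ≤ 0 := by
      rw [im_div_eq']
      have h3 := p.flux_dirichletSolution_pos hz n
      rw [flux] at h3
      have h4 := pos_of_mul_pos_right h3 (p.a_pos (n + 1)).le
      exact div_nonpos_of_nonpos_of_nonneg (neg_nonpos.2 h4.le) (by positivity)
    have h5 : q.im = (p.a (n + 1) * (f (n + 1) / f (n + 2))).im -
        p.a (n + 1) * (d (n + 1) / d (n + 2)).im := by
      simp [q, mul_sub]
    rw [h5]
    nlinarith [p.a_pos (n + 1)]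
  have hup : ‖q‖ ≤ K := by
    have hf2 : ‖f (n + 3) / f (n + 2)‖ ≤ M / z.im := by
      have h1 := (p.im_le_fPlus_div hz (n + 2)).trans
        ((le_abs_self _).trans (Complex.abs_im_le_norm _))
      have h2 : ‖(p.a (n + 2) : ℂ) * (f (n + 2) / f (n + 3))‖ * ‖f (n + 3) / f (n + 2)‖ =
          p.a (n + 2) := by
        rw [← norm_mul]
        have := hfn (n + 2)
        have := hfn (n + 3)
        rw [show (p.a (n + 2) : ℂ) * (f (n + 2) / f (n + 3)) * (f (n + 3) / f (n + 2)) =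
          p.a (n + 2) by field_simp, Complex.norm_real, Real.norm_eq_abs,
          abs_of_pos (p.a_pos _)]
      rw [le_div_iff₀ hz, mul_comm]
      exact (mul_le_mul_of_nonneg_right h1 (norm_nonneg _)).trans (h2.trans_le (ha' _))
    have hd' : ‖d (n + 1) / d (n + 2)‖ ≤ M / z.im := by
      have h1 := (p.im_le_dirichletSolution_div hz n).trans
        ((le_abs_self _).trans (Complex.abs_im_le_norm _))
      have h2 : ‖(p.a (n + 1) : ℂ) * (d (n + 2) / d (n + 1))‖ * ‖d (n + 1) / d (n + 2)‖ =
          p.a (n + 1) := by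
        rw [← norm_mul]
        rw [show (p.a (n + 1) : ℂ) * (d (n + 2) / d (n + 1)) * (d (n + 1) / d (n + 2)) =
          p.a (n + 1) by field_simp, Complex.norm_real, Real.norm_eq_abs,
          abs_of_pos (p.a_pos _)]
      rw [le_div_iff₀ hz, mul_comm]
      exact (mul_le_mul_of_nonneg_right h1 (norm_nonneg _)).trans (h2.trans_le (ha' _))
    -- The difference equation trades the quotient $f(n+1)/f(n+2)$ for $f(n+3)/f(n+2)$, whose
    -- reciprocal is bounded below by `im_le_fPlus_div`.
    have he : q = z - p.b (n + 2) - p.a (n + 2) * (f (n + 3) / f (n + 2))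
        - p.a (n + 1) * (d (n + 1) / d (n + 2)) := by
      have h1 := hfn (n + 2)
      have h2 := p.isSolution_fPlus z (n + 1)
      change (p.a (n + 2) : ℂ) * f (n + 3) + p.a (n + 1) * f (n + 1) + p.b (n + 2) * f (n + 2) =
        z * f (n + 2) at h2
      simp only [q]
      field_simp
      linear_combination d (n + 2) * h2
    have hna : ∀ m, ‖(p.a (m + 1) : ℂ)‖ ≤ M := fun m => by
      rw [Complex.norm_real, Real.norm_eq_abs]; exact ha m
    rw [he]
    refine (norm_sub_le _ _).trans (add_le_add ((norm_sub_le _ _).trans (add_le_add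
      ((norm_sub_le _ _).trans (add_le_add le_rfl ?_)) ?_)) ?_)
    · rw [Complex.norm_real, Real.norm_eq_abs]; exact hb _
    · rw [norm_mul]; exact mul_le_mul (hna _) hf2 (norm_nonneg _) hM.le
    · rw [norm_mul]; exact mul_le_mul (hna _) hd' (norm_nonneg _) hM.le
  rw [hqe]
  exact ⟨inv_anti₀ hq0 hup, inv_anti₀ hz hlow⟩

end Coefficients

/-! ### Determinants of the truncations and asymptotics of $\operatorname{Re}w_+^{(N)}$. -/

namespace Coefficients

variable (p : Coefficients)

/-- The characteristic matrix `z - J_N` of the truncation. -/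
def charMatrix (z : ℂ) (N : ℕ) : Matrix (Fin N) (Fin N) ℂ :=
  Matrix.of fun i j =>
    if (i : ℕ) = j then z - (p.b (i + 1) : ℂ)
    else if (j : ℕ) = i + 1 then -(p.a (i + 1) : ℂ)
    else if (i : ℕ) = j + 1 then -(p.a (j + 1) : ℂ)
    else 0

theorem charMatrix_submatrix (z : ℂ) (N : ℕ) :
    (p.charMatrix z (N + 1)).submatrix Fin.castSucc Fin.castSucc =
      p.charMatrix z N := by
  ext i j
  simp [charMatrix]

theorem det_charMatrix_eq_prod (z : ℂ) (N : ℕ) :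
    (p.charMatrix z N).det =
      ∏ i : Fin N, (z - ((p.truncation_isHermitian N).eigenvalues i : ℂ)) := by
  have h := (p.truncation_isHermitian N).charpoly_eq
  have h2 := congrArg (fun q => (q.map (algebraMap ℝ ℂ)).eval z) h
  simp only [Polynomial.map_prod, Polynomial.eval_prod] at h2
  rw [← Matrix.charpoly_map, Matrix.eval_charpoly] at h2
  have h3 : p.charMatrix z N =
      Matrix.scalar (Fin N) z - (p.truncation N).map (algebraMap ℝ ℂ) := by
    ext i j
    simp only [charMatrix, truncation, Matrix.of_apply, Matrix.sub_apply, Matrix.map_apply,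
      Matrix.scalar_apply, Matrix.diagonal_apply, Fin.ext_iff]
    split_ifs <;> simp
  rw [h3, h2]
  simp

theorem charMatrix_mulVec_dirichletSolution (z : ℂ) (N : ℕ) :
    (p.charMatrix z (N + 1)).mulVec (fun i => p.dirichletSolution z (i + 1)) =
      Pi.single (Fin.last N) ((p.a (N + 1) : ℂ) * p.dirichletSolution z (N + 2)) := by
  set d := p.dirichletSolution z with hd
  have key : ∀ k < N + 1, ∑ j ∈ Finset.range (N + 1),
      (if k = j then z - (p.b (k + 1) : ℂ)
        else if j = k + 1 then -(p.a (k + 1) : ℂ)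
        else if k = j + 1 then -(p.a (j + 1) : ℂ)
        else 0) * d (j + 1) = if k = N then (p.a (N + 1) : ℂ) * d (N + 2) else 0 := by
    intro k hk
    have h1 : ∀ j, (if k = j then z - (p.b (k + 1) : ℂ)
        else if j = k + 1 then -(p.a (k + 1) : ℂ)
        else if k = j + 1 then -(p.a (j + 1) : ℂ)
        else 0) * d (j + 1) = (if k = j then (z - (p.b (k + 1) : ℂ)) * d (k + 1) else 0) +
        (if k + 1 = j then -(p.a (k + 1) : ℂ) * d (k + 2) else 0) +
        (if k = j + 1 then -(p.a k : ℂ) * d k else 0) := by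
      intro j
      rcases lt_trichotomy j k with h | h | h
      · by_cases h' : k = j + 1
        · subst h'; simp [show ¬ j = j + 1 + 1 by omega, show ¬ j + 1 + 1 = j by omega]
        · simp [h', h.ne', show ¬ k + 1 = j by omega, show ¬ j = k + 1 by omega]
      · subst h; simp
      · by_cases h' : k + 1 = j
        · subst h'; simp; omega
        · simp [h.ne, h', Ne.symm h', show ¬ k = j + 1 by omega]
    rw [Finset.sum_congr rfl fun j _ => h1 j, Finset.sum_add_distrib, Finset.sum_add_distrib]
    -- In the first row there is no left neighbor, which is consistent because $d(0)=0$.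
    have h2 : ∑ j ∈ Finset.range (N + 1), (if k = j + 1 then -(p.a k : ℂ) * d k else 0) =
        -(p.a k : ℂ) * d k := by
      cases k with
      | zero => simp [hd, dirichletSolution]
      | succ k =>
        simp only [Nat.add_right_cancel_iff]
        rw [Finset.sum_ite_eq, if_pos (Finset.mem_range.2 (by omega))]
    rw [h2, Finset.sum_ite_eq, Finset.sum_ite_eq, if_pos (Finset.mem_range.2 hk)]
    have h3 := p.isSolution_dirichletSolution z k
    -- The last row lacks its right neighbor; the missing term is the residual at the last site.
    by_cases hkN : k = N
    · subst hkN
      simp only [Finset.mem_range, lt_irrefl, if_false, if_true]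
      linear_combination -h3
    · rw [if_pos (Finset.mem_range.2 (by omega)), if_neg hkN]
      linear_combination -h3
  ext i
  rw [Matrix.mulVec, dotProduct, Pi.single_apply]
  have h := key i i.2
  rw [← Fin.sum_univ_eq_sum_range (fun j => (if (i : ℕ) = j then z - (p.b (i + 1) : ℂ)
        else if j = i + 1 then -(p.a (i + 1) : ℂ)
        else if (i : ℕ) = j + 1 then -(p.a (j + 1) : ℂ)
        else 0) * d (j + 1))] at h
  simpa [charMatrix, Fin.ext_iff] using h

/-- Cramer's rule: apply the adjugate to the identity for $(z-J_{N+1})d$ and read off the last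
coordinate. The corner cofactor is the determinant of size $N$, and the factor $d(N+1)$ cancels
because it is nonzero off the real axis. -/
theorem det_charMatrix_eq {z : ℂ} (hz : 0 < z.im) (N : ℕ) :
    (p.charMatrix z N).det =
      (∏ n ∈ Finset.Icc 1 N, (p.a n : ℂ)) * p.dirichletSolution z (N + 1) := by
  induction N with
  | zero => simp [dirichletSolution]
  | succ N ih =>
    have h := congrArg (fun v => (p.charMatrix z (N + 1)).adjugate.mulVec v (Fin.last N))
      (p.charMatrix_mulVec_dirichletSolution z N)
    simp only [Matrix.mulVec_mulVec, Matrix.adjugate_mul, Matrix.smul_mulVec, Matrix.one_mulVec,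
      Matrix.mulVec_single] at h
    have hd := p.dirichletSolution_ne_zero hz N
    refine mul_right_cancel₀ hd ?_
    rw [Finset.prod_Icc_succ_top (by omega)]
    simp [Matrix.adjugate_fin_succ_eq_det_submatrix, charMatrix_submatrix, ih,
      ← two_mul] at h
    linear_combination h

theorem norm_a_mul_mPlusAt (z : ℂ) (n : ℕ) :
    ‖(p.a n : ℂ) * p.mPlusAt n z‖ = ‖p.fPlus z (n + 1)‖ / ‖p.fPlus z n‖ := by
  have h : (p.a n : ℂ) * p.mPlusAt n z = -(p.fPlus z (n + 1) / p.fPlus z n) := by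
    rw [mPlusAt, div_mul_eq_div_div, div_right_comm, mul_neg, mul_div_cancel₀ _ (p.a_ne_zero n)]
  rw [h, norm_neg, norm_div]

/-- The real parts of the logarithms are $\ln|f_+(n+1)|-\ln|f_+(n)|$, so the sum telescopes. -/
theorem re_wPlus {z : ℂ} (hz : 0 < z.im) (N : ℕ) :
    (p.wPlus N z).re = (N : ℝ)⁻¹ * (Real.log ‖p.fPlus z (N + 1)‖ - Real.log ‖p.fPlus z 1‖) := by
  have h1 : (1 / (N : ℂ)) = (((N : ℝ)⁻¹ : ℝ) : ℂ) := by push_cast; rw [one_div]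
  rw [wPlus, h1, Complex.re_ofReal_mul, Complex.re_sum]
  congr 1
  have h2 : ∀ n, (Complex.log ((p.a n : ℂ) * p.mPlusAt n z)).re =
      Real.log ‖p.fPlus z (n + 1)‖ - Real.log ‖p.fPlus z n‖ := fun n => by
    rw [Complex.log_re, norm_a_mul_mPlusAt, Real.log_div
      (norm_ne_zero_iff.2 (p.fPlus_ne_zero hz _)) (norm_ne_zero_iff.2 (p.fPlus_ne_zero hz _))]
  rw [Finset.sum_congr rfl fun n _ => h2 n]
  induction N with
  | zero => simp
  | succ N ih => rw [Finset.sum_Icc_succ_top (by omega), ih (by push_cast; rw [one_div])]; ring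

theorem integral_eigenvalueMeasure (N : ℕ) (φ : ℝ → ℝ) :
    ∫ t, φ t ∂p.eigenvalueMeasure N =
      (N : ℝ)⁻¹ * ∑ i : Fin N, φ ((p.truncation_isHermitian N).eigenvalues i) := by
  rw [eigenvalueMeasure, integral_smul_measure, integral_finsetSum_measure]
  · simp
  · intro i _
    exact integrable_dirac (by simp)

/-- The logarithm of the decaying solution and the logarithmic potential of the eigenvalues of the
truncations differ by a bounded amount, up to a term that does not depend on `z`. -/
theorem exists_abs_log_fPlus_le {z : ℂ} (hz : 0 < z.im) : ∃ C : ℝ, ∀ N, 1 ≤ N →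
    |Real.log ‖p.fPlus z (N + 1)‖ +
      ∑ i : Fin N, Real.log ‖z - ((p.truncation_isHermitian N).eigenvalues i : ℂ)‖ -
      ∑ n ∈ Finset.Icc 1 N, Real.log (p.a n)| ≤ C := by
  obtain ⟨c, C, hc, h⟩ := p.norm_fPlus_mul_bounds hz
  refine ⟨max |Real.log c| |Real.log C|, fun N hN => ?_⟩
  obtain ⟨n, rfl⟩ : ∃ n, N = n + 1 := ⟨N - 1, by omega⟩
  obtain ⟨h1, h2⟩ := h n
  -- After logarithms, the two expressions for the determinant leave only $\ln|f_+d|$ to be bounded.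
  have hdet := (p.det_charMatrix_eq_prod z (n + 1)).symm.trans (p.det_charMatrix_eq hz (n + 1))
  have hd := p.dirichletSolution_ne_zero hz (n + 1)
  have hf := p.fPlus_ne_zero hz (n + 2)
  have hev : ∀ i : Fin (n + 1),
      z - ((p.truncation_isHermitian (n + 1)).eigenvalues i : ℂ) ≠ 0 := fun i h0 => by
    have := congrArg Complex.im h0
    simp [hz.ne'] at this
  have h3 := congrArg (fun x : ℂ => Real.log ‖x‖) hdet
  simp only [norm_prod, norm_mul] at h3
  rw [Real.log_prod fun i _ => norm_ne_zero_iff.2 (hev i),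
    Real.log_mul (Finset.prod_ne_zero_iff.2 fun i _ => norm_ne_zero_iff.2 (p.a_ne_zero i))
      (norm_ne_zero_iff.2 hd),
    Real.log_prod fun i _ => norm_ne_zero_iff.2 (p.a_ne_zero i)] at h3
  have h4 : ∀ n, ‖(p.a n : ℂ)‖ = p.a n := fun n => by
    rw [Complex.norm_real, Real.norm_eq_abs, abs_of_pos (p.a_pos n)]
  simp only [h4] at h3
  rw [h3]
  have h5 : Real.log ‖p.fPlus z (n + 1 + 1)‖ + (∑ n ∈ Finset.Icc 1 (n + 1), Real.log (p.a n) +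
      Real.log ‖p.dirichletSolution z (n + 1 + 1)‖) -
      ∑ n ∈ Finset.Icc 1 (n + 1), Real.log (p.a n) =
      Real.log ‖p.fPlus z (n + 2) * p.dirichletSolution z (n + 2)‖ := by
    rw [norm_mul, Real.log_mul (norm_ne_zero_iff.2 hf) (norm_ne_zero_iff.2 hd)]
    ring
  rw [h5]
  exact abs_le_max_abs_abs (Real.log_le_log hc h1) (Real.log_le_log (hc.trans_le h1) h2)

/-- The difference of `Re w₊^(N)` at two points is asymptotically given by the logarithmic potential
of the eigenvalue counting measure. -/
theorem tendsto_re_wPlus_sub {z z₀ : ℂ} (hz : 0 < z.im) (hz₀ : 0 < z₀.im) :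
    Tendsto (fun N : ℕ => (p.wPlus N z).re - (p.wPlus N z₀).re +
      ∫ t, (Real.log ‖z - (t : ℂ)‖ - Real.log ‖z₀ - (t : ℂ)‖) ∂p.eigenvalueMeasure N)
      atTop (𝓝 0) := by
  obtain ⟨C, hC⟩ := p.exists_abs_log_fPlus_le hz
  obtain ⟨C₀, hC₀⟩ := p.exists_abs_log_fPlus_le hz₀
  -- The sum of $\ln a(n)$ is the same at both points and drops out; the last term comes from the
  -- lower ends of the telescoping sums.
  set D := C + C₀ + |Real.log ‖p.fPlus z₀ 1‖ - Real.log ‖p.fPlus z 1‖| with hD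
  have hlim : Tendsto (fun N : ℕ => (N : ℝ)⁻¹ * D) atTop (𝓝 0) := by
    simpa using (tendsto_inv_atTop_nhds_zero_nat (𝕜 := ℝ)).mul_const D
  refine squeeze_zero_norm' ?_ hlim
  filter_upwards [eventually_ge_atTop 1] with N hN
  rw [p.re_wPlus hz, p.re_wPlus hz₀, integral_eigenvalueMeasure, ← mul_sub, ← mul_add, norm_mul,
    Real.norm_eq_abs, abs_of_nonneg (by positivity : (0 : ℝ) ≤ (N : ℝ)⁻¹), Finset.sum_sub_distrib,
    Real.norm_eq_abs]
  refine mul_le_mul_of_nonneg_left ?_ (by positivity)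
  have h1 := abs_le.1 (hC N hN)
  have h2 := abs_le.1 (hC₀ N hN)
  have h3 := abs_le.1 (le_refl |Real.log ‖p.fPlus z₀ 1‖ - Real.log ‖p.fPlus z 1‖|)
  rw [abs_le]
  constructor <;> linarith [h1.1, h1.2, h2.1, h2.2, h3.1, h3.2]

/-- The Lyapunov exponent of a limit of the functions `w₊^(N)` is nonnegative. -/
theorem lyapunov_nonneg {N : ℕ → ℕ} (hN : Tendsto N atTop atTop) {w : ℂ → ℂ}
    {z : ℂ} (hz : 0 < z.im) (hw : Tendsto (fun j => p.wPlus (N j) z) atTop (𝓝 (w z))) :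
    0 ≤ lyapunov w z := by
  rw [lyapunov, neg_nonneg]
  have h1 : Tendsto (fun j => (p.wPlus (N j) z).re) atTop (𝓝 (w z).re) :=
    (Complex.continuous_re.tendsto _).comp hw
  have h2 : Tendsto (fun j => ((N j : ℕ) : ℝ)⁻¹ * -Real.log ‖p.fPlus z 1‖) atTop (𝓝 0) := by
    simpa using ((tendsto_inv_atTop_nhds_zero_nat (𝕜 := ℝ)).comp hN).mul_const
      (-Real.log ‖p.fPlus z 1‖)
  refine le_of_tendsto_of_tendsto h1 h2 ?_
  have h3 : ∀ᶠ n in atTop, ‖p.fPlus z (n + 1)‖ < 1 := by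
    have h := ((p.tendsto_fPlus hz).comp (tendsto_add_atTop_nat 1)).norm
    rw [norm_zero] at h
    exact h.eventually_lt_const one_pos
  filter_upwards [hN.eventually h3] with j hj
  rw [p.re_wPlus hz]
  refine mul_le_mul_of_nonneg_left ?_ (by positivity)
  linarith [Real.log_nonpos (norm_nonneg _) hj.le]

end Coefficients

/-! ### Vague limits, the Borel transform and the Thouless formula. -/

section

/-- Vague convergence of measures of mass at most one to a finite measure, tested against a
continuous function that vanishes at infinity. -/
theorem tendsto_integral_of_vague {μ : ℕ → Measure ℝ} {ν : Measure ℝ} [IsFiniteMeasure ν]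
    (hμ : ∀ j, μ j Set.univ ≤ 1)
    (h : ∀ f : ℝ → ℝ, Continuous f → HasCompactSupport f →
      Tendsto (fun j => ∫ t, f t ∂μ j) atTop (𝓝 (∫ t, f t ∂ν)))
    {φ : ℝ → ℝ} (hφ : Continuous φ) (hφ0 : Tendsto φ (cocompact ℝ) (𝓝 0)) :
    Tendsto (fun j => ∫ t, φ t ∂μ j) atTop (𝓝 (∫ t, φ t ∂ν)) := by
  have hfin : ∀ j, IsFiniteMeasure (μ j) := fun j => ⟨(hμ j).trans_lt ENNReal.one_lt_top⟩
  obtain ⟨B, hB⟩ : ∃ B, ∀ t, ‖φ t‖ ≤ B := by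
    let φ' : ZeroAtInftyContinuousMap ℝ ℝ := ⟨⟨φ, hφ⟩, hφ0⟩
    exact ⟨‖φ'.toBCF‖, fun t => φ'.toBCF.norm_coe_le_norm t⟩
  rw [Metric.tendsto_atTop]
  intro ε hε
  set m := ν.real Set.univ with hm
  have hm0 : 0 ≤ m := measureReal_nonneg
  -- The cutoff costs $\delta$ for each $\mu_j$ and $\delta m$ for $\nu$; together this is less than
  -- $\varepsilon/2$.
  set δ := ε / (2 * (2 + m)) with hδ
  have hδ0 : 0 < δ := by positivity
  have hev : ∀ᶠ t in cocompact ℝ, ‖φ t‖ < δ := by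
    have := hφ0.norm
    rw [norm_zero] at this
    exact this.eventually_lt_const hδ0
  obtain ⟨K, hK, hKs⟩ := mem_cocompact.1 hev
  obtain ⟨χ, hχ1, -, hχc, hχ01⟩ := exists_continuous_one_zero_of_isCompact hK
    (isClosed_empty) (Set.disjoint_empty K)
  have hψc : HasCompactSupport fun t => χ t * φ t := hχc.mul_right
  have hψ : Continuous fun t => χ t * φ t := χ.continuous.mul hφ
  have hdiff : ∀ t, ‖φ t - χ t * φ t‖ ≤ δ := fun t => by
    by_cases ht : t ∈ K
    · have : χ t = 1 := hχ1 ht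
      simp [this, hδ0.le]
    · have h1 : ‖φ t‖ < δ := hKs ht
      have h2 := hχ01 t
      rw [show φ t - χ t * φ t = (1 - χ t) * φ t by ring, norm_mul, Real.norm_eq_abs,
        abs_of_nonneg (by linarith [h2.2])]
      calc (1 - χ t) * ‖φ t‖ ≤ 1 * ‖φ t‖ :=
            mul_le_mul_of_nonneg_right (by linarith [h2.1]) (norm_nonneg _)
        _ ≤ δ := by rw [one_mul]; exact h1.le
  have hint : ∀ (ρ : Measure ℝ) [IsFiniteMeasure ρ], |(∫ t, φ t ∂ρ) - ∫ t, χ t * φ t ∂ρ| ≤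
      δ * ρ.real Set.univ := fun ρ _ => by
    have i1 : Integrable φ ρ := Integrable.of_bound hφ.aestronglyMeasurable B
      (ae_of_all _ hB)
    have i2 : Integrable (fun t => χ t * φ t) ρ := by
      refine Integrable.of_bound hψ.aestronglyMeasurable B (ae_of_all _ fun t => ?_)
      rw [norm_mul, Real.norm_eq_abs, abs_of_nonneg (hχ01 t).1]
      calc χ t * ‖φ t‖ ≤ 1 * ‖φ t‖ := mul_le_mul_of_nonneg_right (hχ01 t).2 (norm_nonneg _)
        _ ≤ B := by rw [one_mul]; exact hB t
    rw [← integral_sub i1 i2, ← Real.norm_eq_abs]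
    exact norm_integral_le_of_norm_le_const (ae_of_all _ hdiff)
  obtain ⟨n, hn⟩ := Metric.tendsto_atTop.1 (h _ hψ hψc) (ε / 2) (by positivity)
  refine ⟨n, fun j hj => ?_⟩
  have h1 := hn j hj
  rw [Real.dist_eq] at h1 ⊢
  have h2 := hint (μ j)
  have h3 := hint ν
  have h4 : (μ j).real Set.univ ≤ 1 := by
    rw [measureReal_def]
    exact ENNReal.toReal_le_of_le_ofReal zero_le_one (by simpa using hμ j)
  have h5 : δ * (μ j).real Set.univ ≤ δ := mul_le_of_le_one_right hδ0.le h4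
  have h6 : δ + δ * m < ε / 2 + 0 := by
    rw [hδ]
    have : ε / (2 * (2 + m)) + ε / (2 * (2 + m)) * m = ε / 2 * ((1 + m) / (2 + m)) := by
      field_simp
    rw [this, add_zero]
    exact mul_lt_of_lt_one_right (by positivity) ((div_lt_one (by positivity)).2 (by linarith))
  rw [abs_lt] at h1 ⊢
  rw [abs_le] at h2 h3
  constructor <;> linarith [h1.1, h1.2, h2.1, h2.2, h3.1, h3.2]

theorem isOpen_upperHalf : IsOpen upperHalf := isOpen_lt continuous_const Complex.continuous_im

theorem convex_upperHalf : Convex ℝ upperHalf := convex_halfSpace_im_gt 0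

theorem ofReal_sub_ne_zero {z : ℂ} (hz : 0 < z.im) (t : ℝ) : (t : ℂ) - z ≠ 0 := fun h => by
  have := congrArg Complex.im h
  simp [hz.ne'] at this

theorem im_le_norm_ofReal_sub (z : ℂ) (t : ℝ) : z.im ≤ ‖(t : ℂ) - z‖ := by
  have h := (neg_le_abs _).trans (Complex.abs_im_le_norm ((t : ℂ) - z))
  simpa using h

theorem ofReal_sub_mem_slitPlane {z : ℂ} (hz : 0 < z.im) (t : ℝ) :
    (t : ℂ) - z ∈ Complex.slitPlane := by
  refine Or.inr ?_
  simp [hz.ne']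

/-- Mean value inequality on a half plane where $|1/(t-z)|$ is bounded. The bound is uniform in $t$,
so the normalized logarithm is integrable against any finite measure, without moment conditions. -/
theorem norm_log_sub_log_le {z z₀ : ℂ} (hz : 0 < z.im) (hz₀ : 0 < z₀.im) (t : ℝ) :
    ‖Complex.log ((t : ℂ) - z) - Complex.log ((t : ℂ) - z₀)‖ ≤
      (min z.im z₀.im)⁻¹ * ‖z - z₀‖ := by
  have hδ : 0 < min z.im z₀.im := lt_min hz hz₀
  have hpos : ∀ x ∈ {x : ℂ | min z.im z₀.im ≤ x.im}, 0 < x.im := fun x hx => hδ.trans_le hx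
  refine Convex.norm_image_sub_le_of_norm_hasDerivWithin_le
    (f := fun z => Complex.log ((t : ℂ) - z)) (f' := fun z => -1 / ((t : ℂ) - z))
    (s := {x : ℂ | min z.im z₀.im ≤ x.im}) (fun x hx => ?_) (fun x hx => ?_)
    (convex_halfSpace_im_ge _) (Set.mem_ofPred_eq ▸ min_le_right _ _)
    (Set.mem_ofPred_eq ▸ min_le_left _ _)
  · exact (((hasDerivAt_id x).const_sub (t : ℂ)).clog
      (ofReal_sub_mem_slitPlane (hpos x hx) t)).hasDerivWithinAt
  · rw [norm_div, norm_neg, norm_one, one_div]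
    exact inv_anti₀ hδ ((show min z.im z₀.im ≤ x.im from hx).trans (im_le_norm_ofReal_sub x t))

theorem continuous_log_ofReal_sub {z : ℂ} (hz : 0 < z.im) :
    Continuous fun t : ℝ => Complex.log ((t : ℂ) - z) :=
  (Complex.continuous_ofReal.sub continuous_const).clog fun t => ofReal_sub_mem_slitPlane hz t

theorem norm_one_div_ofReal_sub_le {z : ℂ} (hz : 0 < z.im) (t : ℝ) :
    ‖1 / ((t : ℂ) - z)‖ ≤ z.im⁻¹ := by
  rw [norm_div, norm_one, one_div]
  exact inv_anti₀ hz (im_le_norm_ofReal_sub z t)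

theorem continuous_one_div_ofReal_sub {z : ℂ} (hz : 0 < z.im) :
    Continuous fun t : ℝ => 1 / ((t : ℂ) - z) :=
  continuous_const.div (Complex.continuous_ofReal.sub continuous_const) (ofReal_sub_ne_zero hz)

variable (k : Measure ℝ)

theorem integrable_one_div_ofReal_sub [IsFiniteMeasure k] {z : ℂ} (hz : 0 < z.im) :
    Integrable (fun t : ℝ => 1 / ((t : ℂ) - z)) k :=
  Integrable.of_bound (continuous_one_div_ofReal_sub hz).aestronglyMeasurable _
    (ae_of_all _ (norm_one_div_ofReal_sub_le hz))

/-- The logarithmic potential of `k`, normalized at `i`, as an analytic function. -/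
def complexPotential (z : ℂ) : ℂ :=
  -∫ t : ℝ, (Complex.log ((t : ℂ) - z) - Complex.log ((t : ℂ) - Complex.I)) ∂k

theorem integrable_log_sub_log [IsFiniteMeasure k] {z z₀ : ℂ} (hz : 0 < z.im) (hz₀ : 0 < z₀.im) :
    Integrable (fun t : ℝ => Complex.log ((t : ℂ) - z) - Complex.log ((t : ℂ) - z₀)) k :=
  Integrable.of_bound ((continuous_log_ofReal_sub hz).sub
    (continuous_log_ofReal_sub hz₀)).aestronglyMeasurable _
    (ae_of_all _ (norm_log_sub_log_le hz hz₀))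

theorem hasDerivAt_complexPotential [IsFiniteMeasure k] {z : ℂ} (hz : 0 < z.im) :
    HasDerivAt (complexPotential k) (borelTransform k z) z := by
  have hI : 0 < Complex.I.im := by simp
  have hz2 : 0 < z.im / 2 := by positivity
  have hpos : ∀ x ∈ {x : ℂ | z.im / 2 < x.im}, 0 < x.im := fun x hx => hz2.trans hx
  have hs : {x : ℂ | z.im / 2 < x.im} ∈ 𝓝 z :=
    (isOpen_lt continuous_const Complex.continuous_im).mem_nhds (half_lt_self hz)
  have h := (hasDerivAt_integral_of_dominated_loc_of_deriv_le (μ := k) (𝕜 := ℂ)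
    (F := fun z t => Complex.log ((t : ℂ) - z) - Complex.log ((t : ℂ) - Complex.I))
    (F' := fun z t => -(1 / ((t : ℂ) - z))) (x₀ := z) (bound := fun _ => (z.im / 2)⁻¹) hs
    (by
      filter_upwards [hs] with x hx
      exact (integrable_log_sub_log k (hpos x hx) hI).aestronglyMeasurable)
    (integrable_log_sub_log k hz hI)
    (integrable_one_div_ofReal_sub k hz).neg.aestronglyMeasurable
    (ae_of_all _ fun t x hx => by
      rw [norm_neg]
      exact (norm_one_div_ofReal_sub_le (hpos x hx) t).trans
        (inv_anti₀ hz2 (le_of_lt hx)))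
    (integrable_const _)
    (ae_of_all _ fun t x hx => by
      have := ((hasDerivAt_id x).const_sub (t : ℂ)).clog
        (ofReal_sub_mem_slitPlane (hpos x hx) t)
      simpa [neg_div] using this.sub_const (Complex.log ((t : ℂ) - Complex.I)))).2
  have h2 := h.neg
  rw [integral_neg, neg_neg] at h2
  exact h2

theorem im_one_div_ofReal_sub (z : ℂ) (t : ℝ) :
    (1 / ((t : ℂ) - z)).im = z.im / Complex.normSq ((t : ℂ) - z) := by
  rw [one_div, Complex.inv_im]
  simp

theorem im_borelTransform_pos [IsProbabilityMeasure k] {z : ℂ} (hz : 0 < z.im) :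
    0 < (borelTransform k z).im := by
  have h1 := integrable_one_div_ofReal_sub k hz
  have h2 : (borelTransform k z).im = ∫ t : ℝ, (1 / ((t : ℂ) - z)).im ∂k :=
    (integral_im h1).symm
  have hpos : ∀ t : ℝ, 0 < (1 / ((t : ℂ) - z)).im := fun t => by
    rw [im_one_div_ofReal_sub]
    exact div_pos hz (Complex.normSq_pos.2 (ofReal_sub_ne_zero hz t))
  rw [h2, integral_pos_iff_support_of_nonneg (fun t => (hpos t).le) h1.im]
  have : (Function.support fun t : ℝ => (1 / ((t : ℂ) - z)).im) = Set.univ :=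
    Set.eq_univ_of_forall fun t => (hpos t).ne'
  rw [this]
  simp

/-- It is the derivative of a holomorphic function. -/
theorem differentiableOn_borelTransform [IsFiniteMeasure k] :
    DifferentiableOn ℂ (borelTransform k) upperHalf := by
  have h : DifferentiableOn ℂ (complexPotential k) upperHalf := fun z hz =>
    (hasDerivAt_complexPotential k hz).differentiableAt.differentiableWithinAt
  exact (h.deriv isOpen_upperHalf).congr fun z hz => (hasDerivAt_complexPotential k hz).deriv.symm

theorem isHerglotz_borelTransform [IsProbabilityMeasure k] : IsHerglotz (borelTransform k) :=
  ⟨differentiableOn_borelTransform k, fun _ hz => im_borelTransform_pos k hz⟩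

theorem norm_borelTransform_le [IsProbabilityMeasure k] {z : ℂ} (hz : 0 < z.im) :
    ‖borelTransform k z‖ ≤ z.im⁻¹ := by
  have h := norm_integral_le_of_norm_le_const (μ := k)
    (ae_of_all _ (norm_one_div_ofReal_sub_le hz))
  rwa [probReal_univ, mul_one] at h

variable {k}

/-- Here $(t-z)/(t-z_0)=1+(z_0-z)/(t-z_0)\to1$. This admits the difference as a test function for
vague convergence, with no control on the location of the eigenvalues. -/
theorem tendsto_log_norm_sub_log_norm {z z₀ : ℂ} (hz : 0 < z.im) (hz₀ : 0 < z₀.im) :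
    Tendsto (fun t : ℝ => Real.log ‖z - (t : ℂ)‖ - Real.log ‖z₀ - (t : ℂ)‖) (cocompact ℝ)
      (𝓝 0) := by
  have h0 : Tendsto (fun t : ℝ => (t : ℂ) - z₀) (cocompact ℝ) (Bornology.cobounded ℂ) := by
    rw [← tendsto_norm_atTop_iff_cobounded]
    refine tendsto_atTop_mono (fun t => norm_sub_norm_le (t : ℂ) z₀) ?_
    refine tendsto_atTop_add_const_right _ _ ?_
    exact (tendsto_norm_cocompact_atTop (E := ℝ)).congr fun t => (Complex.norm_real t).symm
  have h1 : Tendsto (fun t : ℝ => 1 + (z₀ - z) * ((t : ℂ) - z₀)⁻¹) (cocompact ℝ) (𝓝 1) := by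
    simpa using ((tendsto_inv₀_cobounded.comp h0).const_mul (z₀ - z)).const_add 1
  have h2 := (Real.continuousAt_log (one_ne_zero)).tendsto.comp (h1.norm.trans (by simp))
  rw [Real.log_one] at h2
  refine h2.congr fun t => ?_
  have e1 := ofReal_sub_ne_zero hz t
  have e2 := ofReal_sub_ne_zero hz₀ t
  rw [Function.comp_apply, norm_sub_rev z, norm_sub_rev z₀,
    ← Real.log_div (norm_ne_zero_iff.2 e1) (norm_ne_zero_iff.2 e2), ← norm_div]
  congr 2
  field_simp
  ring

/-- The Thouless formula: up to a constant, the real part of `w₊` is the real part of the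
logarithmic potential of the density of states. -/
theorem lyapunov_eq {p : Coefficients} {N : ℕ → ℕ} (hN : Tendsto N atTop atTop)
    {w : ℂ → ℂ} (hw : p.ConvergesAlong N w) (hk : p.IsDensityOfStates N k) {z : ℂ}
    (hz : 0 < z.im) :
    lyapunov w z = lyapunov w Complex.I - (complexPotential k z).re := by
  have := hk.1
  have hI : 0 < Complex.I.im := by simp
  have hpt : ∀ z : ℂ, 0 < z.im → Tendsto (fun j => (p.wPlus (N j) z).re) atTop (𝓝 (w z).re) :=
    fun z hz => (Complex.continuous_re.tendsto _).comp
      ((hw.2 {z} isCompact_singleton (Set.singleton_subset_iff.2 hz)).tendsto_at rfl)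
  have h1 := (p.tendsto_re_wPlus_sub hz hI).comp hN
  have hmass : ∀ j, p.eigenvalueMeasure (N j) Set.univ ≤ 1 := fun j => by
    rw [Coefficients.eigenvalueMeasure]
    simp [ENNReal.inv_mul_le_one]
  have hcont : ∀ z : ℂ, 0 < z.im → Continuous fun t : ℝ => Real.log ‖z - (t : ℂ)‖ := fun z hz =>
    (continuous_const.sub Complex.continuous_ofReal).norm.log fun t => by
      change ‖z - (t : ℂ)‖ ≠ 0
      rw [norm_sub_rev]
      exact norm_ne_zero_iff.2 (ofReal_sub_ne_zero hz t)
  have h2 := tendsto_integral_of_vague hmass hk.2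
    ((hcont z hz).sub (hcont Complex.I hI)) (tendsto_log_norm_sub_log_norm hz hI)
  have h3 := ((hpt z hz).sub (hpt Complex.I hI)).add h2
  have h4 := tendsto_nhds_unique h1 h3
  have h5 : (complexPotential k z).re =
      -∫ t : ℝ, (Real.log ‖z - (t : ℂ)‖ - Real.log ‖Complex.I - (t : ℂ)‖) ∂k := by
    rw [complexPotential, Complex.neg_re]
    have h6 := integral_re (integrable_log_sub_log k hz hI)
    rw [RCLike.re_eq_complex_re] at h6
    rw [← h6]
    simp only [Complex.sub_re, Complex.log_re, norm_sub_rev z, norm_sub_rev Complex.I]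
  simp only [Pi.sub_apply] at h4
  rw [lyapunov, lyapunov, h5]
  linarith

/-- The Lyapunov exponent has finite vertical limits at all points of the real line. -/
theorem tendsto_lyapunov {p : Coefficients} {N : ℕ → ℕ} (hN : Tendsto N atTop atTop)
    {w : ℂ → ℂ} (hw : p.ConvergesAlong N w) (hk : p.IsDensityOfStates N k) (t : ℝ) :
    Tendsto (fun y : ℝ => lyapunov w (t + y * Complex.I)) (𝓝[>] 0) (𝓝 (lyapunovReal w t)) := by
  have := hk.1
  refine tendsto_nhds_limUnder ?_
  have him : ∀ y : ℝ, ((t : ℂ) + y * Complex.I).im = y := fun y => by simp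
  -- Along a vertical line the derivative is $-\operatorname{Re}(ig)=\operatorname{Im}g>0$.
  have hd : ∀ y : ℝ, 0 < y → HasDerivAt (fun y : ℝ => -(complexPotential k (t + y * Complex.I)).re)
      (borelTransform k (t + y * Complex.I)).im y := fun y hy => by
    have h1 := hasDerivAt_complexPotential k (z := (t : ℂ) + (y : ℂ) * Complex.I)
      (by rw [him]; exact hy)
    have h2 : HasDerivAt (fun x : ℂ => (t : ℂ) + x * Complex.I) Complex.I (y : ℂ) := by
      simpa using ((hasDerivAt_id (y : ℂ)).mul_const Complex.I).const_add (t : ℂ)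
    have h3 := (h1.comp (y : ℂ) h2).real_of_complex.neg
    exact h3.congr_deriv (by simp)
  have hmono : MonotoneOn (fun y : ℝ => lyapunov w (t + y * Complex.I)) (Set.Ioi 0) := by
    have h1 : MonotoneOn (fun y : ℝ => -(complexPotential k (t + y * Complex.I)).re)
        (Set.Ioi 0) := by
      refine monotoneOn_of_deriv_nonneg (convex_Ioi 0)
        (fun y hy => (hd y hy).continuousAt.continuousWithinAt) ?_ ?_
      · rw [interior_Ioi]
        exact fun y hy => (hd y hy).differentiableAt.differentiableWithinAt
      · rw [interior_Ioi]
        intro y hy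
        rw [(hd y hy).deriv]
        exact (im_borelTransform_pos k (by rw [him]; exact hy)).le
    intro x hx y hy hxy
    have h2 := h1 hx hy hxy
    simp only at h2 ⊢
    rw [lyapunov_eq hN hw hk (z := t + x * Complex.I) (by rw [him]; exact hx),
      lyapunov_eq hN hw hk (z := t + y * Complex.I) (by rw [him]; exact hy)]
    linarith
  -- Monotone in $y$ and bounded below by zero, hence convergent as $y\to0+$.
  refine ⟨_, hmono.tendsto_nhdsGT ⟨0, ?_⟩⟩
  rintro _ ⟨y, hy, rfl⟩
  have hz : 0 < ((t : ℂ) + y * Complex.I).im := by rw [him]; exact hy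
  exact p.lyapunov_nonneg hN hz
    ((hw.2 _ isCompact_singleton (Set.singleton_subset_iff.2 hz)).tendsto_at rfl)

end

/-! ### Cone limits and Fatou's theorem for bounded functions. -/

/-- `G` has the limit `c` at the boundary point `t`, within a cone with vertex `t`. -/
def HasConeLimit (G : ℂ → ℂ) (t : ℝ) (c : ℂ) : Prop :=
  ∀ ε > 0, ∃ δ > 0, ∀ z : ℂ, |z.re - t| ≤ z.im → 0 < z.im → z.im < δ → ‖G z - c‖ ≤ ε

theorem HasConeLimit.tendsto {G : ℂ → ℂ} {t : ℝ} {c : ℂ} (h : HasConeLimit G t c) :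
    Tendsto (fun y : ℝ => G (t + y * Complex.I)) (𝓝[>] 0) (𝓝 c) := by
  rw [Metric.tendsto_nhds]
  intro ε hε
  obtain ⟨δ, hδ, hG⟩ := h (ε / 2) (by positivity)
  filter_upwards [Ioo_mem_nhdsGT hδ] with y hy
  rw [dist_eq_norm]
  exact (hG _ (by simpa using hy.1.le) (by simpa using hy.1) (by simpa using hy.2)).trans_lt
    (by linarith)

theorem norm_le_norm_add_mul_I {z : ℂ} (hz : 0 ≤ z.im) {r : ℝ} (hr : 0 ≤ r) :
    ‖z‖ ≤ ‖z + r * Complex.I‖ := by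
  rw [← sq_le_sq₀ (norm_nonneg _) (norm_nonneg _), ← Complex.normSq_eq_norm_sq,
    ← Complex.normSq_eq_norm_sq, Complex.normSq_apply, Complex.normSq_apply]
  simp
  nlinarith [mul_nonneg hz hr]

theorem le_norm_add_mul_I {z : ℂ} (hz : 0 ≤ z.im) {r : ℝ} :
    r ≤ ‖z + r * Complex.I‖ := by
  have := (le_abs_self _).trans (Complex.abs_im_le_norm (z + r * Complex.I))
  simp at this
  linarith

/-- A maximum principle for functions of linear growth in the upper half plane which are small on
the boundary, near the origin. -/
theorem norm_le_of_linear_growth {H : ℂ → ℂ} (hH : DiffContOnCl ℂ H upperHalf) {L ε δ r : ℝ}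
    (hL : ∀ z : ℂ, 0 ≤ z.im → ‖H z‖ ≤ L * ‖z‖)
    (hs : ∀ s : ℝ, |s| ≤ δ → ‖H s‖ ≤ ε * |s|) (hr : 0 < r) (hrL : 2 * L * r ≤ ε * δ)
    (hε : 0 ≤ ε) (hL0 : 0 ≤ L) {z : ℂ} (hz : 0 ≤ z.im) :
    ‖H z‖ ≤ ε / (2 * r) * ‖z + r * Complex.I‖ ^ 2 := by
  have hden : ∀ z : ℂ, 0 ≤ z.im → 0 < ‖z + r * Complex.I‖ := fun z hz =>
    hr.trans_le (le_norm_add_mul_I hz)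
  -- Rotated to the right half plane and divided by $(z+ir)^2$, which has no zero in the closed half
  -- plane, $H$ becomes bounded, so Phragmén–Lindelöf reduces the claim to the boundary.
  set f : ℂ → ℂ := fun ζ => H (Complex.I * ζ) / (Complex.I * ζ + r * Complex.I) ^ 2 with hf
  have him : ∀ ζ : ℂ, (Complex.I * ζ).im = ζ.re := fun ζ => by simp
  have hbd : ∀ ζ : ℂ, 0 ≤ ζ.re → ‖f ζ‖ ≤ L / r := fun ζ hζ => by
    have h0 := hden _ ((him ζ).symm ▸ hζ)
    have h1 := hL (Complex.I * ζ) ((him ζ).symm ▸ hζ)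
    have h2 := norm_le_norm_add_mul_I (z := Complex.I * ζ) ((him ζ).symm ▸ hζ) hr.le
    have h3 := le_norm_add_mul_I (z := Complex.I * ζ) (r := r) ((him ζ).symm ▸ hζ)
    rw [hf, norm_div, norm_pow, div_le_div_iff₀ (by positivity) hr]
    calc ‖H (Complex.I * ζ)‖ * r ≤ (L * ‖Complex.I * ζ + r * Complex.I‖) *
          ‖Complex.I * ζ + r * Complex.I‖ := by
          refine mul_le_mul (h1.trans ?_) h3 hr.le (by positivity)
          exact mul_le_mul_of_nonneg_left h2 hL0
      _ = _ := by ring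
  have hmaps : Set.MapsTo (fun ζ : ℂ => Complex.I * ζ) {ζ : ℂ | 0 < ζ.re} upperHalf :=
    fun ζ hζ => by
      change 0 < (Complex.I * ζ).im
      rw [him]; exact hζ
  have hdc : DiffContOnCl ℂ f {ζ : ℂ | 0 < ζ.re} := by
    have h1 : DiffContOnCl ℂ (fun ζ : ℂ => H (Complex.I * ζ)) {ζ : ℂ | 0 < ζ.re} :=
      hH.comp (differentiable_id.const_mul Complex.I).diffContOnCl hmaps
    have h2 : DiffContOnCl ℂ (fun ζ : ℂ => (Complex.I * ζ + r * Complex.I) ^ 2)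
        {ζ : ℂ | 0 < ζ.re} :=
      (((differentiable_id.const_mul Complex.I).add_const _).pow 2).diffContOnCl
    have h3 := h2.inv (fun ζ hζ => by
      rw [Complex.closure_setOfPred_lt_re] at hζ
      have := hden (Complex.I * ζ) ((him ζ).symm ▸ hζ)
      exact pow_ne_zero 2 (norm_pos_iff.1 this))
    have h4 := h1.smul h3
    refine ⟨h4.1.congr fun ζ _ => ?_, h4.2.congr fun ζ _ => ?_⟩ <;>
      simp only [hf, smul_eq_mul, Pi.inv_apply, div_eq_mul_inv]
  have key : ∀ ζ : ℂ, 0 ≤ ζ.re → ‖f ζ‖ ≤ ε / (2 * r) := fun ζ hζ => by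
    refine PhragmenLindelof.right_half_plane_of_bounded_on_real hdc ⟨0, by norm_num, 0, ?_⟩ ?_
      (fun x => ?_) hζ
    · refine Asymptotics.IsBigO.of_bound (L / r) ?_
      refine eventually_inf_principal.2 (Eventually.of_forall fun ζ hζ => ?_)
      simpa using hbd ζ (le_of_lt hζ)
    · refine isBoundedUnder_of_eventually_le (a := L / r) ?_
      filter_upwards [eventually_ge_atTop 0] with x hx
      exact hbd x (by simpa using hx)
    · have e : Complex.I * (x * Complex.I) = ((-x : ℝ) : ℂ) := by
        push_cast
        linear_combination (x : ℂ) * Complex.I_mul_I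
      have h0 : 0 < ‖((-x : ℝ) : ℂ) + r * Complex.I‖ := hden _ (by simp)
      have hsq : ‖((-x : ℝ) : ℂ) + r * Complex.I‖ ^ 2 = x ^ 2 + r ^ 2 := by
        rw [← Complex.normSq_eq_norm_sq, Complex.normSq_apply]
        simp
        ring
      -- Near the origin this is $2r|x|\le x^2+r^2$; far away it is the linear growth together with
      -- $2Lr\le\varepsilon\delta$.
      have h4 : 2 * r * ‖H ((-x : ℝ) : ℂ)‖ ≤ ε * (x ^ 2 + r ^ 2) := by
        rcases le_or_gt |x| δ with hx | hx
        · have h5 := hs (-x) (by rwa [abs_neg])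
          rw [abs_neg] at h5
          nlinarith [sq_nonneg (|x| - r), sq_abs x]
        · have h5 := hL ((-x : ℝ) : ℂ) (by simp)
          rw [Complex.norm_real, Real.norm_eq_abs, abs_neg] at h5
          have h6 : 2 * L * r * |x| ≤ ε * |x| * |x| := by
            calc 2 * L * r * |x| ≤ ε * δ * |x| := by gcongr
              _ ≤ ε * |x| * |x| := by gcongr
          nlinarith [sq_abs x, mul_nonneg hε (sq_nonneg r)]
      simp only [hf]
      rw [e, norm_div, norm_pow, hsq, div_le_div_iff₀ (by positivity) (by positivity)]
      linarith
  have hz' := key (-Complex.I * z) (by simpa using hz)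
  have e : Complex.I * (-Complex.I * z) = z := by
    linear_combination -z * Complex.I_mul_I
  simp only [hf] at hz'
  rw [e, norm_div, norm_pow, div_le_iff₀ (by have := hden z hz; positivity)] at hz'
  exact hz'

/-- A Lipschitz function which is analytic in the upper half plane and differentiable along the real
line at `t` has a derivative with a cone limit at `t`. -/
theorem hasConeLimit_of_hasDerivAt {W G : ℂ → ℂ} {L : NNReal} (hW : LipschitzWith L W)
    (hG : ∀ z : ℂ, 0 < z.im → HasDerivAt W (G z) z) {t : ℝ} {c : ℂ}
    (ht : HasDerivAt (fun s : ℝ => W s) c t) : HasConeLimit G t c := by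
  -- Subtracting the linear part leaves linear growth globally and $o(|s|)$ on the real axis.
  set H : ℂ → ℂ := fun z => W (t + z) - W t - c * z with hH
  set K : ℝ := L + ‖c‖ with hK
  have hK0 : 0 ≤ K := by positivity
  have hHd : ∀ z : ℂ, 0 < z.im → HasDerivAt H (G (t + z) - c) z := fun z hz => by
    have h1 := (hG (t + z) (by simpa using hz)).comp_const_add (t : ℂ) z
    exact ((h1.sub_const (W t)).sub ((hasDerivAt_id z).const_mul c)).congr_deriv (by simp)
  have hHc : Continuous H := by
    have := hW.continuous
    fun_prop
  have hHdc : DiffContOnCl ℂ H upperHalf :=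
    ⟨fun z hz => (hHd z hz).differentiableAt.differentiableWithinAt, hHc.continuousOn⟩
  have hHL : ∀ z : ℂ, 0 ≤ z.im → ‖H z‖ ≤ K * ‖z‖ := fun z _ => by
    have h1 := hW.norm_sub_le (t + z) t
    rw [add_sub_cancel_left] at h1
    calc ‖H z‖ ≤ ‖W (t + z) - W t‖ + ‖c * z‖ := norm_sub_le _ _
      _ ≤ L * ‖z‖ + ‖c‖ * ‖z‖ := by rw [norm_mul]; gcongr
      _ = K * ‖z‖ := by rw [hK]; ring
  intro ε₀ hε₀
  -- Cauchy's estimate on a disc of radius $r/2$, where $|H|\le\frac92\varepsilon r$, gives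
  -- $9\varepsilon$.
  set ε := ε₀ / 9 with hε
  have hε0 : 0 < ε := by positivity
  obtain ⟨δ, hδ, hs⟩ : ∃ δ > 0, ∀ s : ℝ, |s| ≤ δ → ‖H s‖ ≤ ε * |s| := by
    have h1 := (hasDerivAt_iff_isLittleO_nhds_zero.1 ht).bound hε0
    obtain ⟨δ, hδ, h2⟩ := Metric.eventually_nhds_iff.1 h1
    refine ⟨δ / 2, by positivity, fun s hs => ?_⟩
    have h3 := h2 (y := s) (by rw [Real.dist_eq, sub_zero]; linarith)
    simpa [hH, mul_comm] using h3
  refine ⟨ε * δ / (2 * K + 1), by positivity, fun z hzt hz hzδ => ?_⟩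
  set r := z.im with hr
  have hrL : 2 * K * r ≤ ε * δ := by
    rw [lt_div_iff₀ (by positivity)] at hzδ
    nlinarith
  set z' : ℂ := z - t with hz'
  have hz'im : z'.im = r := by simp [hz', hr]
  -- In the cone $|z'|\le\sqrt2\,r$, so the disc of radius $r/2$ stays in the upper half plane and
  -- within distance $2r$ of the origin.
  have hz'n : ‖z'‖ ≤ 3 / 2 * r := by
    rw [← sq_le_sq₀ (norm_nonneg _) (by positivity), ← Complex.normSq_eq_norm_sq,
      Complex.normSq_apply, hz'im]
    have h1 : z'.re = z.re - t := by simp [hz']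
    have h2 := abs_le.1 hzt
    rw [h1]
    nlinarith [h2.1, h2.2]
  have hball : ∀ ζ ∈ Metric.closedBall z' (r / 2), 0 < ζ.im ∧ ‖ζ‖ ≤ 2 * r := fun ζ hζ => by
    rw [mem_closedBall_iff_norm] at hζ
    constructor
    · have h1 := (neg_le_abs _).trans ((Complex.abs_im_le_norm (ζ - z')).trans hζ)
      simp only [Complex.sub_im] at h1
      linarith
    · have := norm_le_norm_add_norm_sub' ζ z'
      linarith
  have h1 : ‖deriv H z'‖ ≤ (9 / 2 * ε * r) / (r / 2) := by
    refine Complex.norm_deriv_le_of_forall_mem_sphere_norm_le (by positivity) ?_ ?_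
    · refine ⟨fun ζ hζ => (hHd ζ (hball ζ (Metric.ball_subset_closedBall hζ)).1).differentiableAt
        |>.differentiableWithinAt, hHc.continuousOn⟩
    · intro ζ hζ
      obtain ⟨h2, h3⟩ := hball ζ (Metric.sphere_subset_closedBall hζ)
      have h4 := norm_le_of_linear_growth hHdc hHL hs hz hrL hε0.le hK0 h2.le
      have h5 : ‖ζ + r * Complex.I‖ ≤ 3 * r := by
        refine (norm_add_le _ _).trans ?_
        rw [norm_mul, Complex.norm_I, Complex.norm_real, Real.norm_eq_abs, abs_of_pos hz]
        linarith
      calc ‖H ζ‖ ≤ ε / (2 * r) * ‖ζ + r * Complex.I‖ ^ 2 := h4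
        _ ≤ ε / (2 * r) * (3 * r) ^ 2 := by gcongr
        _ = 9 / 2 * ε * r := by field_simp; ring
  rw [(hHd z' (hz'im ▸ hz)).deriv] at h1
  have h2 : (9 / 2 * ε * r) / (r / 2) = ε₀ := by rw [hε]; field_simp
  rw [h2] at h1
  simpa [hz'] using h1

/-- An analytic function on the upper half plane has a primitive. -/
theorem exists_primitive {G : ℂ → ℂ} (hG : DifferentiableOn ℂ G upperHalf) :
    ∃ W : ℂ → ℂ, ∀ z : ℂ, 0 < z.im → HasDerivAt W (G z) z := by
  -- The Cayley map pulls the problem back to the unit disc; the factor $2i/(1-\zeta)^2$ below is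
  -- $\varphi'$.
  set φ : ℂ → ℂ := fun ζ => Complex.I * (1 + ζ) / (1 - ζ) with hφ
  have h1ζ : ∀ ζ ∈ Metric.ball (0 : ℂ) 1, 1 - ζ ≠ 0 := fun ζ hζ h => by
    rw [mem_ball_zero_iff, ← sub_eq_zero.1 h, norm_one] at hζ
    exact lt_irrefl _ hζ
  have hφm : Set.MapsTo φ (Metric.ball (0 : ℂ) 1) upperHalf := fun ζ hζ => by
    have h1 := h1ζ ζ hζ
    rw [mem_ball_zero_iff, ← sq_lt_one_iff₀ (norm_nonneg _), ← Complex.normSq_eq_norm_sq,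
      Complex.normSq_apply] at hζ
    change 0 < (φ ζ).im
    simp only [hφ]
    rw [Coefficients.im_div_eq]
    refine div_pos ?_ (pow_pos (norm_pos_iff.2 h1) 2)
    simp
    nlinarith
  have hφd : DifferentiableOn ℂ φ (Metric.ball (0 : ℂ) 1) := fun ζ hζ => by
    have := h1ζ ζ hζ
    exact (DifferentiableAt.div (by fun_prop) (by fun_prop) this).differentiableWithinAt
  have hFd : DifferentiableOn ℂ (fun ζ => G (φ ζ) * (2 * Complex.I / (1 - ζ) ^ 2))
      (Metric.ball (0 : ℂ) 1) := by
    refine (hG.comp hφd hφm).mul fun ζ hζ => ?_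
    have : (1 - ζ) ^ 2 ≠ 0 := pow_ne_zero 2 (h1ζ ζ hζ)
    exact ((differentiableAt_const _).div
      (((differentiableAt_const (1 : ℂ)).sub differentiableAt_id).pow 2) this
      ).differentiableWithinAt
  obtain ⟨V, hV⟩ := hFd.isExactOn_ball
  refine ⟨fun z => V ((z - Complex.I) / (z + Complex.I)), fun z hz => ?_⟩
  have hzI : z + Complex.I ≠ 0 := fun h => by
    have := congrArg Complex.im h
    simp at this
    linarith
  have hm : (z - Complex.I) / (z + Complex.I) ∈ Metric.ball (0 : ℂ) 1 := by
    rw [mem_ball_zero_iff, norm_div, div_lt_one (norm_pos_iff.2 hzI),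
      ← sq_lt_sq₀ (norm_nonneg _) (norm_nonneg _), ← Complex.normSq_eq_norm_sq,
      ← Complex.normSq_eq_norm_sq, Complex.normSq_apply, Complex.normSq_apply]
    simp
    nlinarith
  have h1 : HasDerivAt (fun z : ℂ => (z - Complex.I) / (z + Complex.I))
      (2 * Complex.I / (z + Complex.I) ^ 2) z := by
    refine (((hasDerivAt_id z).sub_const Complex.I).div
      ((hasDerivAt_id z).add_const Complex.I) hzI).congr_deriv ?_
    simp only [id]
    ring
  have h2 : 1 - (z - Complex.I) / (z + Complex.I) = 2 * Complex.I / (z + Complex.I) := by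
    field_simp
    ring
  have h3 : φ ((z - Complex.I) / (z + Complex.I)) = z := by
    simp only [hφ]
    rw [h2]
    have := Complex.I_ne_zero
    field_simp
    ring
  refine ((hV _ hm).comp z h1).congr_deriv ?_
  simp only [h3, h2]
  have := Complex.I_ne_zero
  field_simp

/-- **Fatou's theorem** for bounded analytic functions on the upper half plane. -/
theorem ae_exists_hasConeLimit {G : ℂ → ℂ} (hG : DifferentiableOn ℂ G upperHalf) {L : NNReal}
    (hL : ∀ z : ℂ, 0 < z.im → ‖G z‖ ≤ L) : ∀ᵐ t : ℝ, ∃ c, HasConeLimit G t c := by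
  -- The primitive is Lipschitz, so after extension to the closed half plane it is differentiable at
  -- almost every real point, and there its derivative $G$ has a cone limit.
  obtain ⟨W, hW⟩ := exists_primitive hG
  have hlip : LipschitzOnWith L W upperHalf :=
    convex_upperHalf.lipschitzOnWith_of_nnnorm_hasDerivWithin_le
      (fun z hz => (hW z hz).hasDerivWithinAt) fun z hz => hL z hz
  obtain ⟨V, hV, hVW⟩ := hlip.extend_finite_dimension
  have hVd : ∀ z : ℂ, 0 < z.im → HasDerivAt V (G z) z := fun z hz =>
    (hW z hz).congr_of_eventuallyEq
      ((hVW.symm).eventuallyEq_of_mem (isOpen_upperHalf.mem_nhds hz))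
  have hre : LipschitzWith _ (fun s : ℝ => V s) :=
    hV.comp (LipschitzWith.of_dist_le_mul (K := 1) fun x y => by
      rw [NNReal.coe_one, one_mul]; exact (Complex.isometry_ofReal.dist_eq x y).le)
  filter_upwards [hre.ae_differentiableAt_real] with t ht
  exact ⟨_, hasConeLimit_of_hasDerivAt hV hVd ht.hasDerivAt⟩

/-! ### Fatou's theorem for the Borel transform. -/

section

/-- The Poisson formula at the point `i` for a bounded function that is analytic in a neighborhood
of the closed upper half plane. -/
theorem integral_div_one_add_sq {F : ℂ → ℂ} {η M : ℝ} (hη : 0 < η)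
    (hF : DifferentiableOn ℂ F {z | -η < z.im}) (hM : ∀ z : ℂ, 0 ≤ z.im → ‖F z‖ ≤ M) :
    Integrable (fun s : ℝ => F s / (1 + s ^ 2)) ∧
      ∫ s : ℝ, F s / (1 + s ^ 2) = Real.pi * F Complex.I := by
  have hM0 : 0 ≤ M := (norm_nonneg _).trans (hM Complex.I (by simp))
  have hopen : IsOpen {z : ℂ | -η < z.im} := isOpen_lt continuous_const Complex.continuous_im
  have hFc : Continuous fun s : ℝ => F s := by
    refine continuous_iff_continuousAt.2 fun s => ?_
    have h := (hF.differentiableAt (hopen.mem_nhds (x := (s : ℂ)) (by simpa using hη))).continuousAt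
    exact h.comp Complex.continuous_ofReal.continuousAt
  have hone : ∀ s : ℝ, (1 + (s : ℂ) ^ 2) = ((1 + s ^ 2 : ℝ) : ℂ) := fun s => by push_cast; rfl
  have hone0 : ∀ s : ℝ, (1 + (s : ℂ) ^ 2) ≠ 0 := fun s => by
    rw [hone]; exact_mod_cast (by positivity : (1 + s ^ 2 : ℝ) ≠ 0)
  have hint : ∀ f : ℝ → ℂ, Continuous f → (∀ s, ‖f s‖ ≤ M) →
      Integrable fun s : ℝ => f s / (1 + (s : ℂ) ^ 2) := fun f hf hfM => by
    refine Integrable.mono' (integrable_inv_one_add_sq.const_mul M)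
      (hf.div (by fun_prop) hone0).aestronglyMeasurable (ae_of_all _ fun s => ?_)
    rw [norm_div, hone, Complex.norm_real, Real.norm_eq_abs, abs_of_pos (by positivity),
      div_eq_mul_inv]
    exact mul_le_mul_of_nonneg_right (hfM s) (by positivity)
  have i1 := hint _ hFc (fun s => hM s (by simp))
  have i2 := hint (fun _ => F Complex.I) continuous_const (fun _ => hM _ (by simp))
  refine ⟨i1, ?_⟩
  have hconst : ∫ s : ℝ, F Complex.I / (1 + (s : ℂ) ^ 2) = Real.pi * F Complex.I := by
    have h1 : ∀ s : ℝ, F Complex.I / (1 + (s : ℂ) ^ 2) =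
        F Complex.I * (((1 + s ^ 2)⁻¹ : ℝ) : ℂ) := fun s => by
      rw [hone, Complex.ofReal_inv, div_eq_mul_inv]
    simp_rw [h1]
    rw [integral_const_mul, integral_complex_ofReal, integral_univ_inv_one_add_sq, mul_comm]
  rw [← hconst, ← sub_eq_zero, ← integral_sub i1 i2]
  -- This is $(F(z)-F(i))/(z^2+1)$ with the singularity at $i$ removed, so Cauchy's theorem applies
  -- without a residue.
  set Φ : ℂ → ℂ := fun z => dslope F Complex.I z / (z + Complex.I) with hΦ
  have hΦe : ∀ z : ℂ, z ≠ Complex.I → Φ z = (F z - F Complex.I) / (z ^ 2 + 1) := fun z hz => by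
    simp only [hΦ]
    rw [dslope_of_ne _ hz, slope_def_field, div_div]
    congr 1
    linear_combination -Complex.I_mul_I
  have hΦr : ∀ s : ℝ, Φ s = F s / (1 + (s : ℂ) ^ 2) - F Complex.I / (1 + (s : ℂ) ^ 2) := fun s => by
    rw [hΦe s (fun h => by simpa using congrArg Complex.im h), add_comm, sub_div]
  have hΦd : DifferentiableOn ℂ Φ {z | -η < z.im ∧ -1 < z.im} := by
    have h1 : DifferentiableOn ℂ (dslope F Complex.I) {z | -η < z.im} :=
      (Complex.differentiableOn_dslope (hopen.mem_nhds (by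
        change -η < Complex.I.im; simp; linarith))).2 hF
    refine (h1.mono fun z hz => hz.1).div (by fun_prop) fun z hz h => ?_
    have h2 := congrArg Complex.im h
    have h3 : -1 < z.im := hz.2
    simp at h2
    linarith
  have hbound : ∀ (R : ℝ) (z : ℂ), 2 ≤ R → R ≤ ‖z‖ → 0 ≤ z.im → ‖Φ z‖ ≤ 2 * M / (R ^ 2 - 1) :=
    fun R z hR hz hz0 => by
      rw [hΦe z (fun h => by rw [h, Complex.norm_I] at hz; linarith), norm_div]
      have h1 : ‖F z - F Complex.I‖ ≤ 2 * M :=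
        (norm_sub_le _ _).trans (by linarith [hM z hz0, hM Complex.I (by simp)])
      have h2 : R ^ 2 - 1 ≤ ‖z ^ 2 + 1‖ := by
        have h3 := norm_sub_le_norm_add (z ^ 2) 1
        rw [norm_pow, norm_one] at h3
        nlinarith
      exact div_le_div₀ (by positivity) h1 (by nlinarith) h2
  -- The factor $4R$ is the length of the top and the two vertical sides of the rectangle
  -- $[-R,R]\times[0,R]$.
  have hlim0 : Tendsto (fun R : ℝ => 2 * M / (R ^ 2 - 1) * (4 * R)) atTop (𝓝 0) := by
    have h1 : Tendsto (fun R : ℝ => R - R⁻¹) atTop atTop := by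
      refine tendsto_atTop_mono' _ ?_ (tendsto_atTop_add_const_right _ (-1 : ℝ) tendsto_id)
      filter_upwards [eventually_ge_atTop 1] with R hR
      have := inv_le_one_of_one_le₀ hR
      simp only [id]
      linarith
    refine (h1.const_div_atTop (8 * M)).congr' ?_
    filter_upwards [eventually_ge_atTop 2] with R hR
    have : R ^ 2 - 1 ≠ 0 := by nlinarith
    have h2 : R - R⁻¹ = (R ^ 2 - 1) / R := by field_simp
    rw [h2]
    field_simp
    ring
  have hlim : Tendsto (fun R : ℝ => ∫ s in (-R)..R, Φ s) atTop
      (𝓝 (∫ s : ℝ, Φ s)) := by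
    refine intervalIntegral_tendsto_integral ?_ tendsto_neg_atTop_atBot tendsto_id
    exact (i1.sub i2).congr (ae_of_all _ fun s => (hΦr s).symm)
  simp_rw [← hΦr]
  refine tendsto_nhds_unique hlim (squeeze_zero_norm' ?_ hlim0)
  filter_upwards [eventually_ge_atTop 2] with R hR
  have hrect := Complex.integral_boundary_rect_eq_zero_of_differentiableOn Φ ((-R : ℝ) : ℂ)
    ((R : ℂ) + R * Complex.I) (hΦd.mono fun z hz => by
      have h2 := hz.2
      simp only [Set.mem_preimage, Complex.ofReal_im, Complex.add_im, Complex.mul_im,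
        Complex.ofReal_re, Complex.I_im, Complex.I_re, mul_one, mul_zero, add_zero, zero_add] at h2
      rw [Set.uIcc_of_le (by linarith)] at h2
      exact ⟨by linarith [h2.1], by linarith [h2.1]⟩)
  simp only [Complex.ofReal_re, Complex.ofReal_im, Complex.add_re, Complex.add_im, Complex.mul_re,
    Complex.mul_im, Complex.I_re, Complex.I_im, mul_zero, mul_one, sub_zero, add_zero, zero_add,
    Complex.ofReal_zero, zero_mul] at hrect
  have e1 : ‖∫ x : ℝ in (-R)..R, Φ (x + R * Complex.I)‖ ≤ 2 * M / (R ^ 2 - 1) * |R - -R| :=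
    intervalIntegral.norm_integral_le_of_norm_le_const fun x _ =>
      hbound R _ hR (by
        have := (le_abs_self _).trans (Complex.abs_im_le_norm (x + R * Complex.I))
        simpa using this) (by simp; linarith)
  have e2 : ∀ x : ℝ, |x| = R →
      ‖∫ y : ℝ in (0 : ℝ)..R, Φ (x + y * Complex.I)‖ ≤ 2 * M / (R ^ 2 - 1) * |R - 0| := fun x hx =>
    intervalIntegral.norm_integral_le_of_norm_le_const fun y hy => by
      rw [Set.uIoc_of_le (by linarith)] at hy
      refine hbound R _ hR ?_ (by simpa using hy.1.le)
      have := Complex.abs_re_le_norm (x + y * Complex.I)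
      simpa [hx] using this
  have hR0 : |R| = R := abs_of_nonneg (by linarith)
  have e3 := e2 R hR0
  have e4 := e2 (-R) (by rw [abs_neg, hR0])
  rw [show R - -R = 2 * R by ring, abs_mul, abs_two, hR0] at e1
  rw [sub_zero, hR0] at e3 e4
  have e5 : ∫ x : ℝ in (-R)..R, Φ x = (∫ x : ℝ in (-R)..R, Φ (x + R * Complex.I)) -
      Complex.I • (∫ y : ℝ in (0 : ℝ)..R, Φ (R + y * Complex.I)) +
      Complex.I • ∫ y : ℝ in (0 : ℝ)..R, Φ (((-R : ℝ) : ℂ) + y * Complex.I) := by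
    linear_combination hrect
  rw [e5]
  refine (norm_add_le _ _).trans ((add_le_add (norm_sub_le _ _) le_rfl).trans ?_)
  rw [norm_smul, norm_smul, Complex.norm_I, one_mul, one_mul]
  linarith

variable (k : Measure ℝ) [IsProbabilityMeasure k]

theorem one_le_norm_borelTransform_add_I {z : ℂ} (hz : 0 < z.im) :
    1 ≤ ‖borelTransform k z + Complex.I‖ := by
  have h1 := (le_abs_self _).trans (Complex.abs_im_le_norm (borelTransform k z + Complex.I))
  have h2 := im_borelTransform_pos k hz
  simp at h1
  linarith

/-- Averages of `log |g + i|` along horizontal lines are bounded. -/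
theorem lintegral_log_borelTransform_le {y : ℝ} (hy : 0 < y) :
    ∫⁻ s : ℝ, ENNReal.ofReal
      (Real.log ‖borelTransform k (s + y * Complex.I) + Complex.I‖ / (1 + s ^ 2)) ≤
      ENNReal.ofReal (Real.pi * Real.log 2) := by
  -- Shifting up by $y$ makes $g$ bounded and analytic across the real line. The real part is
  -- nonnegative because $|g+i|\ge1$, and its value at $i$ is at most $\ln2$ for every $y$.
  set F : ℂ → ℂ := fun z => Complex.log (borelTransform k (z + y * Complex.I) + Complex.I) with hF
  have hmaps : ∀ z : ℂ, -y < z.im → 0 < (z + y * Complex.I).im := fun z hz => by simp; linarith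
  have hslit : ∀ z : ℂ, 0 < z.im → borelTransform k z + Complex.I ∈ Complex.slitPlane :=
    fun z hz => by
      have := im_borelTransform_pos k hz
      refine Or.inr ?_
      simp
      linarith
  have hFd : DifferentiableOn ℂ F {z | -y < z.im} := by
    refine DifferentiableOn.clog ?_ fun z hz => hslit _ (hmaps z hz)
    exact ((differentiableOn_borelTransform k).comp (by fun_prop)
      fun z hz => hmaps z hz).add_const _
  have hnorm : ∀ z : ℂ, 0 ≤ z.im →
      ‖borelTransform k (z + y * Complex.I) + Complex.I‖ ≤ y⁻¹ + 1 := fun z hz => by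
    refine (norm_add_le _ _).trans (add_le_add ?_ Complex.norm_I.le)
    refine (norm_borelTransform_le k (hmaps z (by linarith))).trans (inv_anti₀ hy ?_)
    simpa using hz
  have hFM : ∀ z : ℂ, 0 ≤ z.im → ‖F z‖ ≤ Real.log (y⁻¹ + 1) + Real.pi := fun z hz => by
    have h1 := one_le_norm_borelTransform_add_I k (hmaps z (by linarith))
    refine (Complex.norm_le_abs_re_add_abs_im _).trans (add_le_add ?_ ?_)
    · rw [Complex.log_re, abs_of_nonneg (Real.log_nonneg h1)]
      exact Real.log_le_log (by linarith) (hnorm z hz)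
    · rw [Complex.log_im]
      exact Complex.abs_arg_le_pi _
  obtain ⟨h1, h2⟩ := integral_div_one_add_sq hy hFd hFM
  have hre : ∀ s : ℝ, (F s / (1 + (s : ℂ) ^ 2)).re =
      Real.log ‖borelTransform k (s + y * Complex.I) + Complex.I‖ / (1 + s ^ 2) := fun s => by
    rw [show (1 + (s : ℂ) ^ 2) = ((1 + s ^ 2 : ℝ) : ℂ) by push_cast; rfl, Complex.div_ofReal_re,
      Complex.log_re]
  have h3 := h1.re
  simp only [RCLike.re_eq_complex_re, hre] at h3
  rw [← ofReal_integral_eq_lintegral_ofReal h3 (ae_of_all _ fun s => ?_)]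
  · refine ENNReal.ofReal_le_ofReal ?_
    have h4 : ∫ s : ℝ, Real.log ‖borelTransform k (s + y * Complex.I) + Complex.I‖ / (1 + s ^ 2) =
        Real.pi * (F Complex.I).re := by
      have h5 := integral_re h1
      simp only [RCLike.re_eq_complex_re, hre] at h5
      rw [h5, h2, Complex.re_ofReal_mul]
    rw [h4, Complex.log_re]
    refine mul_le_mul_of_nonneg_left ?_ Real.pi_pos.le
    have hI := hmaps Complex.I (by simp; linarith)
    refine Real.log_le_log (zero_lt_one.trans_le (one_le_norm_borelTransform_add_I k hI)) ?_
    refine (norm_add_le _ _).trans ?_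
    have h6 := norm_borelTransform_le k hI
    have h7 : (Complex.I + y * Complex.I).im⁻¹ ≤ 1 := inv_le_one_of_one_le₀ (by simp; linarith)
    rw [Complex.norm_I]
    linarith
  · have := one_le_norm_borelTransform_add_I k (hmaps s (by simpa using hy))
    exact div_nonneg (Real.log_nonneg this) (by positivity)

theorem continuous_borelTransform_line {y : ℝ} (hy : 0 < y) :
    Continuous fun s : ℝ => borelTransform k (s + y * Complex.I) := by
  refine (differentiableOn_borelTransform k).continuousOn.comp_continuous (by fun_prop) fun s => ?_
  change 0 < ((s : ℂ) + y * Complex.I).im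
  simpa using hy

/-- By Fatou's lemma along $y=1/(n+1)$, the lower limit of $\ln|g+i|/(1+s^2)$ has finite integral,
hence is finite almost everywhere. This excludes the limit zero for $1/(g+i)$. -/
theorem ae_not_tendsto_borelTransform :
    ∀ᵐ t : ℝ, ¬ Tendsto (fun y : ℝ => ‖borelTransform k (t + y * Complex.I)‖) (𝓝[>] 0) atTop := by
  set y : ℕ → ℝ := fun n => 1 / ((n : ℝ) + 1) with hy
  have hypos : ∀ n, 0 < y n := fun n => Nat.one_div_pos_of_nat
  have hylim : Tendsto y atTop (𝓝[>] 0) :=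
    tendsto_nhdsWithin_iff.2 ⟨tendsto_one_div_add_atTop_nhds_zero_nat, Eventually.of_forall hypos⟩
  set u : ℕ → ℝ → ℝ≥0∞ := fun n s => ENNReal.ofReal
      (Real.log ‖borelTransform k (s + y n * Complex.I) + Complex.I‖ / (1 + s ^ 2)) with hu
  have humeas : ∀ n, Measurable (u n) := fun n => by
    have h1 := (continuous_borelTransform_line k (hypos n)).measurable
    exact ((((h1.add_const _).norm).log).div (by fun_prop)).ennreal_ofReal
  have hfin : ∫⁻ s, liminf (fun n => u n s) atTop ≠ ∞ := by
    refine ne_top_of_le_ne_top (ENNReal.ofReal_ne_top (r := Real.pi * Real.log 2)) ?_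
    refine (lintegral_liminf_le humeas).trans ?_
    refine liminf_le_of_le (by isBoundedDefault) fun b hb => ?_
    obtain ⟨n, hn⟩ := hb.exists
    exact hn.trans (lintegral_log_borelTransform_le k (hypos n))
  filter_upwards [ae_lt_top (Measurable.liminf humeas) hfin] with t ht hlim
  refine ht.ne (Tendsto.liminf_eq ?_)
  refine ENNReal.tendsto_ofReal_atTop.comp ?_
  refine Tendsto.atTop_div_const (by positivity) (Real.tendsto_log_atTop.comp ?_)
  refine tendsto_atTop_mono (fun n => norm_sub_le_norm_add _ _) ?_
  exact tendsto_atTop_add_const_right _ _ (hlim.comp hylim)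

/-- **Fatou's theorem** for the Borel transform of a probability measure. -/
theorem ae_exists_hasConeLimit_borelTransform :
    ∀ᵐ t : ℝ, ∃ c, HasConeLimit (borelTransform k) t c := by
  have hne : ∀ z : ℂ, 0 < z.im → borelTransform k z + Complex.I ≠ 0 := fun z hz =>
    norm_pos_iff.1 (zero_lt_one.trans_le (one_le_norm_borelTransform_add_I k hz))
  -- The function $1/(g+i)$ is bounded by $1$, so the bounded case applies; a nonzero limit can be
  -- inverted.
  have hG : DifferentiableOn ℂ (fun z => (borelTransform k z + Complex.I)⁻¹) upperHalf :=
    ((differentiableOn_borelTransform k).add_const _).inv hne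
  have hL : ∀ z : ℂ, 0 < z.im → ‖(borelTransform k z + Complex.I)⁻¹‖ ≤ (1 : NNReal) := fun z hz => by
    rw [norm_inv, NNReal.coe_one]
    exact inv_le_one_of_one_le₀ (one_le_norm_borelTransform_add_I k hz)
  filter_upwards [ae_exists_hasConeLimit hG hL, ae_not_tendsto_borelTransform k] with t ht hnt
  obtain ⟨c, hc⟩ := ht
  have hc0 : c ≠ 0 := by
    rintro rfl
    refine hnt ?_
    have h1 := hc.tendsto.norm
    rw [norm_zero] at h1
    have h2 : Tendsto (fun y : ℝ => ‖(borelTransform k (t + y * Complex.I) + Complex.I)⁻¹‖)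
        (𝓝[>] 0) (𝓝[>] 0) := by
      refine tendsto_nhdsWithin_iff.2 ⟨h1, ?_⟩
      filter_upwards [self_mem_nhdsWithin] with y hy
      exact norm_pos_iff.2 (inv_ne_zero (hne _ (by simpa using hy)))
    have h3 := tendsto_inv_nhdsGT_zero.comp h2
    refine tendsto_atTop_mono (fun y => ?_) (tendsto_atTop_add_const_right _ (-1 : ℝ) h3)
    simp only [Function.comp_apply, norm_inv, inv_inv]
    have := norm_add_le (borelTransform k (t + y * Complex.I)) Complex.I
    rw [Complex.norm_I] at this
    linarith
  refine ⟨c⁻¹ - Complex.I, fun ε hε => ?_⟩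
  have h1 := (continuousAt_inv₀ hc0)
  obtain ⟨η, hη, h2⟩ := Metric.continuousAt_iff.1 h1 ε hε
  obtain ⟨δ, hδ, h3⟩ := hc (η / 2) (by positivity)
  refine ⟨δ, hδ, fun z hz1 hz2 hz3 => ?_⟩
  have h4 := h2 (x := (borelTransform k z + Complex.I)⁻¹)
    (by rw [dist_eq_norm]; exact (h3 z hz1 hz2 hz3).trans_lt (by linarith))
  rw [inv_inv, dist_eq_norm] at h4
  rw [show borelTransform k z - (c⁻¹ - Complex.I) = borelTransform k z + Complex.I - c⁻¹ by ring]
  exact h4.le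

end

/-! ### Level sets of the boundary values and the derivative. -/

theorem convex_truncatedCone (t δ : ℝ) :
    Convex ℝ {z : ℂ | |z.re - t| ≤ z.im ∧ 0 < z.im ∧ z.im < δ} := by
  have h1 : {z : ℂ | |z.re - t| ≤ z.im ∧ 0 < z.im ∧ z.im < δ} =
      {z : ℂ | (Complex.reLm - Complex.imLm) z ≤ t} ∩ {z : ℂ | t ≤ (Complex.reLm + Complex.imLm) z} ∩
        ({z : ℂ | 0 < z.im} ∩ {z : ℂ | z.im < δ}) := by
    ext z
    simp only [Set.mem_ofPred_eq, Set.mem_inter_iff, abs_le, LinearMap.sub_apply,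
      LinearMap.add_apply, Complex.reLm_coe, Complex.imLm_coe]
    constructor
    · rintro ⟨⟨h1, h2⟩, h3, h4⟩
      exact ⟨⟨by linarith, by linarith⟩, h3, h4⟩
    · rintro ⟨⟨h1, h2⟩, h3, h4⟩
      exact ⟨⟨by linarith, by linarith⟩, h3, h4⟩
  rw [h1]
  exact ((convex_halfSpace_le (LinearMap.isLinear _) t).inter
    (convex_halfSpace_ge (LinearMap.isLinear _) t)).inter
    ((convex_halfSpace_im_gt 0).inter (convex_halfSpace_im_lt δ))

/-- Mean value estimate in a cone, up to the vertex, for the real part of an analytic function whose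
derivative is close to a constant. -/
theorem abs_re_sub_le_of_cone {v g : ℂ → ℂ} (hv : ∀ z : ℂ, 0 < z.im → HasDerivAt v (g z) z)
    {t δ ε l : ℝ} {q : ℂ}
    (hg : ∀ z : ℂ, |z.re - t| ≤ z.im → 0 < z.im → z.im < δ → ‖g z - q‖ ≤ ε)
    (ht : Tendsto (fun y : ℝ => (v (t + y * Complex.I)).re) (𝓝[>] 0) (𝓝 l))
    {m : ℂ} (hm : |m.re - t| ≤ m.im) (hm0 : 0 < m.im) (hmδ : m.im < δ) :
    |(v m).re - l - (q * (m - t)).re| ≤ ε * ‖m - t‖ := by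
  have hy0 : Tendsto (fun y : ℝ => (t : ℂ) + y * Complex.I) (𝓝[>] 0) (𝓝 (t : ℂ)) := by
    have h : Continuous fun y : ℝ => (t : ℂ) + y * Complex.I := by fun_prop
    simpa using (h.tendsto 0).mono_left nhdsWithin_le_nhds
  have hlim1 : Tendsto (fun y : ℝ => |(v m).re - (v (t + y * Complex.I)).re -
      (q * (m - (t + y * Complex.I))).re|) (𝓝[>] 0) (𝓝 |(v m).re - l - (q * (m - t)).re|) :=
    ((ht.const_sub _).sub ((Complex.continuous_re.tendsto _).comp
      ((hy0.const_sub m).const_mul q))).abs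
  have hlim2 : Tendsto (fun y : ℝ => ε * ‖m - (t + y * Complex.I)‖) (𝓝[>] 0)
      (𝓝 (ε * ‖m - t‖)) := (hy0.const_sub m).norm.const_mul ε
  refine le_of_tendsto_of_tendsto hlim1 hlim2 ?_
  -- The vertex is approached by $t+iy$ inside the convex cone, where the mean value inequality
  -- holds for $v-qz$.
  filter_upwards [Ioo_mem_nhdsGT (hm0.trans hmδ)] with y hy
  have h := (convex_truncatedCone t δ).norm_image_sub_le_of_norm_hasDerivWithin_le
    (f := fun z => v z - q * z) (f' := fun z => g z - q) (x := (t : ℂ) + y * Complex.I) (y := m)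
    (C := ε)
    (fun z hz => ((hv z hz.2.1).sub
      (((hasDerivAt_id z).const_mul q).congr_deriv (mul_one q))).hasDerivWithinAt)
    (fun z hz => hg z hz.1 hz.2.1 hz.2.2) ⟨by simpa using hy.1.le, by simpa using hy.1,
      by simpa using hy.2⟩ ⟨hm, hm0, hmδ⟩
  refine le_trans ?_ ((Complex.abs_re_le_norm _).trans h)
  refine le_of_eq (congrArg _ ?_)
  rw [mul_sub]
  simp only [Complex.sub_re]
  ring

/-- On a set where the real boundary values of `v` are constant, the boundary values of the
derivative of `v` are imaginary, with countably many exceptions. -/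
theorem countable_levelSet_inter {v g : ℂ → ℂ} (hv : ∀ z : ℂ, 0 < z.im → HasDerivAt v (g z) z)
    {l : ℝ → ℝ}
    (hl : ∀ t : ℝ, Tendsto (fun y : ℝ => (v (t + y * Complex.I)).re) (𝓝[>] 0) (𝓝 (l t))) (a : ℝ) :
    {t : ℝ | l t = a ∧ ∃ c, HasConeLimit g t c ∧ c.re ≠ 0}.Countable := by
  -- Countably many classes make the estimate uniform: a common cone height and a common approximate
  -- limit $q$ from a dense sequence.
  set S : ℕ → ℕ → Set ℝ := fun n i => {t : ℝ | l t = a ∧ (TopologicalSpace.denseSeq ℂ i).re ≠ 0 ∧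
    ∀ z : ℂ, |z.re - t| ≤ z.im → 0 < z.im → z.im < 1 / ((n : ℝ) + 1) →
      ‖g z - TopologicalSpace.denseSeq ℂ i‖ ≤ |(TopologicalSpace.denseSeq ℂ i).re| / 3} with hS
  have hsub : {t : ℝ | l t = a ∧ ∃ c, HasConeLimit g t c ∧ c.re ≠ 0} ⊆ ⋃ n, ⋃ i, S n i := by
    rintro t ⟨hta, c, hc, hc0⟩
    have hc1 : 0 < |c.re| := abs_pos.2 hc0
    obtain ⟨i, hi⟩ := (TopologicalSpace.denseRange_denseSeq ℂ).exists_dist_lt c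
      (ε := |c.re| / 10) (by positivity)
    obtain ⟨δ, hδ, hG⟩ := hc (|c.re| / 10) (by positivity)
    obtain ⟨n, hn⟩ := exists_nat_one_div_lt hδ
    rw [dist_eq_norm] at hi
    set q := TopologicalSpace.denseSeq ℂ i with hq
    have hre : 9 / 10 * |c.re| ≤ |q.re| := by
      have h1 := Complex.abs_re_le_norm (c - q)
      rw [Complex.sub_re] at h1
      have h2 := abs_sub_abs_le_abs_sub c.re q.re
      linarith
    refine Set.mem_iUnion.2 ⟨n, Set.mem_iUnion.2 ⟨i, hta, ?_, fun z h1 h2 h3 => ?_⟩⟩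
    · exact abs_pos.1 (by linarith)
    · have h4 := hG z h1 h2 (h3.trans hn)
      have h5 := norm_sub_le_norm_sub_add_norm_sub (g z) c q
      change ‖g z - q‖ ≤ |q.re| / 3
      linarith
  refine Set.Countable.mono hsub (Set.countable_iUnion fun n => Set.countable_iUnion fun i => ?_)
  have hδ : 0 < 1 / ((n : ℝ) + 1) := Nat.one_div_pos_of_nat
  set δ := 1 / ((n : ℝ) + 1)
  have hsep : ∀ s ∈ S n i, ∀ t ∈ S n i, s < t → s + δ ≤ t := by
    rintro s ⟨hsa, hq0, hsc⟩ t ⟨hta, -, htc⟩ hst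
    by_contra! hlt
    set q := TopologicalSpace.denseSeq ℂ i
    -- The apex of the right isosceles triangle over $[s,t]$ lies on the boundary of both cones.
    set m : ℂ := ⟨(s + t) / 2, (t - s) / 2⟩ with hm
    have hm0 : 0 < m.im := by simp only [hm]; linarith
    have hmδ : m.im < δ := by simp only [hm]; linarith
    have hmt : |m.re - t| = (t - s) / 2 := by
      simp only [hm]
      rw [abs_of_nonpos (by linarith)]
      ring
    have hms : |m.re - s| = (t - s) / 2 := by
      simp only [hm]
      rw [abs_of_nonneg (by linarith)]
      ring
    have h1 := abs_re_sub_le_of_cone hv htc (hl t) (m := m) hmt.le hm0 hmδ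
    have h2 := abs_re_sub_le_of_cone hv hsc (hl s) (m := m) hms.le hm0 hmδ
    have hn : ∀ x : ℝ, |m.re - x| = (t - s) / 2 → ‖m - x‖ ≤ t - s := fun x hx => by
      refine (Complex.norm_le_abs_re_add_abs_im _).trans ?_
      rw [Complex.sub_re, Complex.sub_im, Complex.ofReal_re, Complex.ofReal_im, sub_zero, hx]
      simp only [hm]
      rw [abs_of_pos (by linarith)]
      linarith
    have hq1 : 0 < |q.re| := abs_pos.2 hq0
    have h3 := h1.trans (mul_le_mul_of_nonneg_left (hn t hmt) (by positivity))
    have h4 := h2.trans (mul_le_mul_of_nonneg_left (hn s hms) (by positivity))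
    -- Subtracting the two estimates at $m$ eliminates $v(m)$ and the equal boundary values, leaving
    -- $\operatorname{Re}q\,(t-s)$; the resulting factor $2/3$ is absurd.
    have h5 : |q.re| * (t - s) ≤ |q.re| / 3 * (t - s) + |q.re| / 3 * (t - s) := by
      refine le_trans (le_of_eq ?_) ((abs_sub _ _).trans (add_le_add h3 h4))
      rw [hta, hsa, ← abs_of_pos (sub_pos.2 hst), ← abs_mul]
      congr 1
      simp only [Complex.mul_re, Complex.sub_re, Complex.sub_im, Complex.ofReal_re,
        Complex.ofReal_im]
      ring
    nlinarith [mul_pos hq1 (sub_pos.2 hst)]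
  refine Set.PairwiseDisjoint.countable_of_Ioo (y := fun x => x + δ) (fun s hs t ht hne => ?_)
    fun x _ => by linarith
  have aux : ∀ s ∈ S n i, ∀ t ∈ S n i, s < t → Disjoint (Set.Ioo s (s + δ)) (Set.Ioo t (t + δ)) :=
    fun s hs t ht hst => Set.disjoint_left.2 fun x hx hx' => by
      have := hsep s hs t ht hst
      linarith [hx.2, hx'.1]
  rcases hne.lt_or_gt with h | h
  · exact aux s hs t ht h
  · exact (aux t ht s hs h).symm

/-! ### From the function $g$ to the measure $dk$, and the conclusion. -/

/-- For a finite measure the compensating term is integrable by itself, and this $\alpha$ cancels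
it. -/
theorem herglotzIntegral_eq_borelTransform (k : Measure ℝ) [IsProbabilityMeasure k] {z : ℂ}
    (hz : 0 < z.im) :
    herglotzIntegral (∫ t : ℝ, t / (t ^ 2 + 1) ∂k) 0 k z = borelTransform k z := by
  have h1 : Integrable (fun t : ℝ => (t : ℂ) / ((t : ℂ) ^ 2 + 1)) k := by
    have h2 : Integrable (fun t : ℝ => t / (t ^ 2 + 1)) k := by
      refine Integrable.of_bound (C := 1) (Continuous.div (by fun_prop) (by fun_prop)
        fun t => by positivity).aestronglyMeasurable (ae_of_all _ fun t => ?_)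
      rw [Real.norm_eq_abs, abs_div, abs_of_pos (by positivity : 0 < t ^ 2 + 1),
        div_le_one (by positivity)]
      nlinarith [sq_abs t, sq_nonneg (|t| - 1)]
    refine h2.ofReal.congr (ae_of_all _ fun t => ?_)
    simp
  rw [herglotzIntegral, integral_sub (integrable_one_div_ofReal_sub k hz) h1, borelTransform,
    ← integral_complex_ofReal]
  simp

theorem herglotzIntegral_mem_reflectionlessFunctions {k : Measure ℝ} [IsProbabilityMeasure k]
    {E : Set ℝ} (h : borelTransform k ∈ reflectionlessFunctions E) :
    herglotzIntegral (∫ t : ℝ, t / (t ^ 2 + 1) ∂k) 0 k ∈ reflectionlessFunctions E := by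
  obtain ⟨⟨h1, h2⟩, h3⟩ := h
  have e : ∀ z : ℂ, 0 < z.im → _ := fun z hz => herglotzIntegral_eq_borelTransform k hz
  refine ⟨⟨h1.congr e, fun z hz => ?_⟩, ?_⟩
  · rw [e z hz]
    exact h2 hz
  · filter_upwards [h3] with t ht htE
    obtain ⟨c, hc, hc0⟩ := ht htE
    refine ⟨c, hc.congr' ?_, hc0⟩
    filter_upwards [self_mem_nhdsWithin] with y hy
    exact (e _ (by simpa using hy)).symm

theorem locallyConstantSet_subset (γ : ℝ → ℝ) : locallyConstantSet γ ⊆ γ ⁻¹' fatValues γ :=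
  fun t ht => Measure.measure_pos_of_mem_nhds volume (show γ ⁻¹' {γ t} ∈ 𝓝 t from ht)

/-- A pointwise limit of continuous functions along $y=1/(n+1)$; measurability is needed for the
countability of the fat values. -/
theorem measurable_lyapunovReal {w : ℂ → ℂ} (hw : IsHerglotz w)
    (h : ∀ t : ℝ, Tendsto (fun y : ℝ => lyapunov w (t + y * Complex.I)) (𝓝[>] 0)
      (𝓝 (lyapunovReal w t))) : Measurable (lyapunovReal w) := by
  have hypos : ∀ n : ℕ, 0 < 1 / ((n : ℝ) + 1) := fun n => Nat.one_div_pos_of_nat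
  refine measurable_of_tendsto_metrizable
    (f := fun (n : ℕ) (t : ℝ) => lyapunov w (t + ((1 / ((n : ℝ) + 1) : ℝ) : ℂ) * Complex.I))
    (fun n => ?_) (tendsto_pi_nhds.2 fun t => (h t).comp (tendsto_nhdsWithin_iff.2
      ⟨tendsto_one_div_add_atTop_nhds_zero_nat, Eventually.of_forall hypos⟩))
  refine (Complex.continuous_re.comp (hw.1.continuousOn.comp_continuous (by fun_prop)
    fun t => ?_)).neg.measurable
  change 0 < ((t : ℂ) + ((1 / ((n : ℝ) + 1) : ℝ) : ℂ) * Complex.I).im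
  rw [Complex.add_im, Complex.ofReal_im, Complex.im_ofReal_mul, Complex.I_im, zero_add, mul_one]
  exact hypos n

end Jacobi

end

theorem corollary4p1 (p : Jacobi.Coefficients) (N : ℕ → ℕ) (hN : Tendsto N atTop atTop)
    (w : ℂ → ℂ) (hw : p.ConvergesAlong N w)
    (k : Measure ℝ) (hk : p.IsDensityOfStates N k) :
    (∀ t : ℝ, Tendsto (fun y : ℝ => Jacobi.lyapunov w (t + y * Complex.I)) (𝓝[>] 0)
      (𝓝 (Jacobi.lyapunovReal w t))) ∧
    Jacobi.borelTransform k ∈ Jacobi.reflectionlessFunctions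
      (Jacobi.lyapunovReal w ⁻¹' Jacobi.fatValues (Jacobi.lyapunovReal w)) ∧
    k ∈ Jacobi.reflectionlessMeasures
      (Jacobi.locallyConstantSet (Jacobi.lyapunovReal w)) := by
  have hprob := hk.1
  have hlim := Jacobi.tendsto_lyapunov hN hw hk
  have hmeas := Jacobi.measurable_lyapunovReal hw.1 hlim
  -- Level sets are disjoint and Lebesgue measure is $\sigma$-finite, so only countably many have
  -- positive measure.
  have hfat : (Jacobi.fatValues (Jacobi.lyapunovReal w)).Countable :=
    Measure.countable_meas_level_set_pos hmeas
  have hpot : ∀ t : ℝ, Tendsto (fun y : ℝ => (Jacobi.complexPotential k (t + y * Complex.I)).re)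
      (𝓝[>] 0) (𝓝 (Jacobi.lyapunov w Complex.I - Jacobi.lyapunovReal w t)) := fun t => by
    refine ((hlim t).const_sub (Jacobi.lyapunov w Complex.I)).congr' ?_
    filter_upwards [self_mem_nhdsWithin] with y hy
    rw [Jacobi.lyapunov_eq hN hw hk (z := t + y * Complex.I) (by simpa using hy)]
    ring
  have hrefl : Jacobi.borelTransform k ∈ Jacobi.reflectionlessFunctions
      (Jacobi.lyapunovReal w ⁻¹' Jacobi.fatValues (Jacobi.lyapunovReal w)) := by
    refine ⟨Jacobi.isHerglotz_borelTransform k, ?_⟩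
    -- Each fat level contributes a countable exceptional set; the level $c$ of $\gamma$ is the
    -- level $\gamma(i)-c$ of the potential.
    have hex := (ae_ball_iff hfat).2 fun c _ =>
      (Jacobi.countable_levelSet_inter (fun z hz => Jacobi.hasDerivAt_complexPotential k hz) hpot
        (Jacobi.lyapunov w Complex.I - c)).ae_notMem volume
    filter_upwards [Jacobi.ae_exists_hasConeLimit_borelTransform k, hex] with t ht hex htC
    obtain ⟨c, hc⟩ := ht
    refine ⟨c, hc.tendsto, ?_⟩
    by_contra hc0
    exact hex _ htC ⟨rfl, c, hc, hc0⟩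
  refine ⟨hlim, hrefl, ?_, ∫ t : ℝ, t / (t ^ 2 + 1) ∂k, 0, le_rfl,
    Jacobi.herglotzIntegral_mem_reflectionlessFunctions ⟨hrefl.1, ?_⟩⟩
  · refine lt_of_le_of_lt (lintegral_mono (g := fun _ => 1) fun t => ?_) (by simp)
    rw [← ENNReal.ofReal_one]
    exact ENNReal.ofReal_le_ofReal ((div_le_one (by positivity)).2 (by nlinarith [sq_nonneg t]))
  · filter_upwards [hrefl.2] with t ht htU
    exact ht (Jacobi.locallyConstantSet_subset _ htU)
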